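/- Let $n\ge 1$, let $w_1,\dots,w_n$ be positive integers, put $\mu=1+w_1+\cdots+w_n$, $U=(\mathbb{C}^*)^n$ with coordinates $u_1,\dots,u_n$, and $$F(u,x)=u_1+\cdots+u_n+\frac{x}{u_1^{w_1}\cdots u_n^{w_n}} .$$ Let $$G=\frac{\Omega^n(U)[\tau,\tau^{-1},x,x^{-1}]}{(d_u-\tau d_uF\wedge)\,\Omega^{n-1}(U)[\tau,\tau^{-1},x,x^{-1}]}$$ be the Gauss–Manin system of $F$, with the connection $\nabla_{\partial_\tau}(\omega\tau^i)=i\omega\tau^{i-1}-F\omega\tau^i$, $\nabla_{\partial_x}(\omega\tau^i)=\frac{\partial\omega}{\partial x}\tau^i-\frac{\partial F}{\partial x}\omega\tau^{i+1}$, and let $\theta=\tau^{-1}$. Let $s_0\le s_1\le\cdots\le s_{\mu-1}$ be the elements, in increasing order, of the disjoint union over $i=0,\dots,n$ of the sets $\{\ell\mu/w_i\mid 0\le\ell<w_i\}$, where $w_0=1$, and let $\alpha_k=k-s_k$. Define $\omega^\varphi_0,\dots,\omega^\varphi_{\mu-1}\in G$ by $\omega_0^\varphi=\left[\frac{du_1}{u_1}\wedge\cdots\wedge\frac{du_n}{u_n}\right]$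 and $$-\tfrac1\mu\,(\tau\nabla_{\partial_\tau}+\alpha_k)\,\omega_k^\varphi=\tau\,\omega_{k+1}^\varphi\qquad(0\le k\le\mu-2).$$ Let $\mathcal L_0^\varphi$ (resp. $\mathcal L_\infty^\varphi$) be the $\mathbb{C}[x,\theta]$-submodule (resp. $\mathbb{C}[x,\tau]$-submodule) of $G$ generated by the $\omega_k^\varphi$, and let $E^{\log}=\mathcal L_0^\varphi/\theta\mathcal L_0^\varphi$, $E_\infty=\mathcal L_\infty^\varphi/\tau\mathcal L_\infty^\varphi$. These two $\mathbb{C}[x]$-modules are identified by $[\omega_k^\varphi]\leftrightarrow[\omega_k^\varphi]$. A *Frobenius type structure with logarithmic pole along $x=0$* is a tuple $(E,R_0,R_\infty,\Phi,\bigtriangledown,g)$ where $E$ is a free $\mathbb{C}[x]$-module of finite rank, $R_0,R_\infty$ are $\mathbb{C}[x]$-linear endomorphisms of $E$, $\Phi:E\to\Omega^1(\log\{x=0\})\otimes E$ is $\mathbb{C}[x]$-linear, $\bigtriangledown$ is a connection on $E$ with logarithmic pole along $x=0$, and $g$ is a symmetric non-degenerate $\mathbb{C}[x]$-bilinear form on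 $E$ (non-degenerate: $E\to\mathrm{Hom}_{\mathbb{C}[x]}(E,\mathbb{C}[x])$ is an isomorphism), such that $$\text{(a)}\quad \bigtriangledown^2=0,\quad \bigtriangledown(R_\infty)=0,\quad \Phi\wedge\Phi=0,\quad [R_0,\Phi]=0,\quad \bigtriangledown(\Phi)=0,\quad \bigtriangledown(R_0)+\Phi=[\Phi,R_\infty],$$ $$\text{(b)}\quad \bigtriangledown(g)=0,\quad \Phi^*=\Phi,\quad R_0^*=R_0,\quad R_\infty+R_\infty^*=r\,\mathrm{Id}\ \text{ for some constant } r\in\mathbb{C},$$ where $(\ )^*$ is the adjoint for $g$. Without $g$ and (b), the tuple is a *Frobenius type structure with logarithmic pole, without metric*. **Statement.** There are uniquely determined $R_0,R_\infty,\Phi,\bigtriangledown$ as above and a unique $\mathbb{C}[x]$-bilinear form $g$ on $E^{\log}$ such that, for all $i,j,k\in\{0,\dots,\mu-1\}$ and all logarithmic vector fields $\xi\in Der(\log\{x=0\})$, $$R_0[\omega_k^\varphi]=[\theta^2\nabla_{\partial_\theta}\omega_k^\varphi],\qquad \Phi_\xi[\omega_k^\varphi]=[\theta\nabla_\xi\omega_k^\varphi]\qquad\text{(classes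 in } E^{\log}),$$ $$R_\infty[\omega_k^\varphi]=[\nabla_{\tau\partial_\tau}\omega_k^\varphi],\qquad \bigtriangledown_\xi[\omega_k^\varphi]=[\nabla_\xi\omega_k^\varphi]\qquad\text{(classes in } E_\infty),$$ $$g([\omega_i^\varphi],[\omega_j^\varphi])=\begin{cases}1 & i+j=n,\\ c\,x & i,j\ge n+1,\ i+j=\mu+n,\\ 0&\text{otherwise,}\end{cases}\qquad c=\prod_{l=1}^n w_l^{-w_l}$$ (the brackets on the right being classes of elements which do lie in $\mathcal L_0^\varphi$, resp. $\mathcal L_\infty^\varphi$). Moreover: 1. If $\mu=n+1$, then $(E^{\log},R_0,R_\infty,\Phi,\bigtriangledown,g)$ is a Frobenius type structure with logarithmic pole along $x=0$. 2. If $\mu\ge n+2$, then $(E^{\log},R_0,R_\infty,\Phi,\bigtriangledown)$ is a Frobenius type structure with logarithmic pole along $x=0$ without metric. In this case $g$ is symmetric, flat ($\bigtriangledown(g)=0$), and satisfies all the relations (b), but it is not non-degenerate. -/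

import Mathlib

open Polynomial

noncomputable section

namespace GaussManin

/-! ### Rings of Laurent polynomials and their derivations -/

/-- The derivation `m ↦ ℓ(m) m` on monomials `m` of a (Laurent) polynomial ring `k[M]`,
for an additive character `ℓ` of the exponents. -/
def eulerDer {k M : Type*} [CommRing k] [AddCommMonoid M] (ℓ : M →+ k) :
    Derivation k (AddMonoidAlgebra k M) (AddMonoidAlgebra k M) :=
  Derivation.mk'
    ((Finsupp.lsum k fun m => ℓ m • AddMonoidAlgebra.lsingle (R := k) (S := k) m) ∘ₗ
      (AddMonoidAlgebra.coeffLinearEquiv (M := M) (S := k) k).toLinearMap) (by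
    have key : ∀ (m : M) (c : k),
        ((Finsupp.lsum k fun m => ℓ m • AddMonoidAlgebra.lsingle (R := k) (S := k) m) ∘ₗ
          (AddMonoidAlgebra.coeffLinearEquiv (M := M) (S := k) k).toLinearMap)
          (AddMonoidAlgebra.single m c) = AddMonoidAlgebra.single m (ℓ m * c) := by
      intro m c
      simp [AddMonoidAlgebra.coeffLinearEquiv]
    intro a b
    induction a using AddMonoidAlgebra.induction_linear with
    | zero => simp
    | add f g hf hg => simp only [add_mul, map_add, hf, hg, smul_eq_mul, mul_add]; ring
    | single m c =>
      induction b using AddMonoidAlgebra.induction_linear with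
      | zero => simp
      | add f g hf hg => simp only [mul_add, map_add, hf, hg, smul_eq_mul, add_mul]; ring
      | single m' c' =>
        rw [AddMonoidAlgebra.single_mul_single, key, key, key, smul_eq_mul, smul_eq_mul,
          AddMonoidAlgebra.single_mul_single, AddMonoidAlgebra.single_mul_single, add_comm m' m,
          ← AddMonoidAlgebra.single_add, map_add]
        congr 1
        ring)

theorem eulerDer_single {k M : Type*} [CommRing k] [AddCommMonoid M] (ℓ : M →+ k) (m : M) (c : k) :
    eulerDer ℓ (AddMonoidAlgebra.single m c) = AddMonoidAlgebra.single m (ℓ m * c) := by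
  simp [eulerDer, AddMonoidAlgebra.coeffLinearEquiv]

/-- The derivation of `k[M]` which applies a derivation of `k` to all coefficients. -/
def coeffDer {k M : Type*} [CommRing k] [Algebra ℂ k] [AddCommMonoid M] (D : Derivation ℂ k k) :
    Derivation ℂ (AddMonoidAlgebra k M) (AddMonoidAlgebra k M) :=
  Derivation.mk'
    ((AddMonoidAlgebra.coeffLinearEquiv (M := M) (S := k) ℂ).symm.toLinearMap ∘ₗ
      Finsupp.mapRange.linearMap D.toLinearMap ∘ₗ
      (AddMonoidAlgebra.coeffLinearEquiv (M := M) (S := k) ℂ).toLinearMap) (by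
    have key : ∀ (m : M) (c : k),
        ((AddMonoidAlgebra.coeffLinearEquiv (M := M) (S := k) ℂ).symm.toLinearMap ∘ₗ
          Finsupp.mapRange.linearMap D.toLinearMap ∘ₗ
          (AddMonoidAlgebra.coeffLinearEquiv (M := M) (S := k) ℂ).toLinearMap)
          (AddMonoidAlgebra.single m c) = AddMonoidAlgebra.single m (D c) := by
      intro m c
      simp [AddMonoidAlgebra.coeffLinearEquiv]
    intro a b
    induction a using AddMonoidAlgebra.induction_linear with
    | zero => simp
    | add f g hf hg => simp only [add_mul, map_add, hf, hg, smul_eq_mul, mul_add]; ring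
    | single m c =>
      induction b using AddMonoidAlgebra.induction_linear with
      | zero => simp
      | add f g hf hg => simp only [mul_add, map_add, hf, hg, smul_eq_mul, add_mul]; ring
      | single m' c' =>
        rw [AddMonoidAlgebra.single_mul_single, key, key, key, smul_eq_mul, smul_eq_mul,
          AddMonoidAlgebra.single_mul_single, AddMonoidAlgebra.single_mul_single, add_comm m' m,
          ← AddMonoidAlgebra.single_add, Derivation.leibniz, smul_eq_mul, smul_eq_mul])

theorem coeffDer_single {k M : Type*} [CommRing k] [Algebra ℂ k] [AddCommMonoid M]
    (D : Derivation ℂ k k) (m : M) (c : k) :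
    coeffDer D (AddMonoidAlgebra.single m c) = AddMonoidAlgebra.single m (D c) := by
  simp [coeffDer, AddMonoidAlgebra.coeffLinearEquiv]

/-- `ℂ[x, x⁻¹, τ, τ⁻¹]`; the exponent `(i, l)` is that of `x ^ i τ ^ l`. -/
abbrev Base : Type := AddMonoidAlgebra ℂ (ℤ × ℤ)

/-- The variable `x`. -/
def xB : Base := AddMonoidAlgebra.single (1, 0) 1

/-- The variable `τ`. -/
def tauB : Base := AddMonoidAlgebra.single (0, 1) 1

/-- The variable `θ = τ⁻¹`. -/
def thetaB : Base := AddMonoidAlgebra.single (0, -1) 1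

/-- `∂ₓ = x⁻¹ (x ∂ₓ)` on `ℂ[x, x⁻¹, τ, τ⁻¹]`. -/
def dxB : Derivation ℂ Base Base :=
  (AddMonoidAlgebra.single (-1, 0) 1 : Base) •
    eulerDer ((Int.castAddHom ℂ).comp (AddMonoidHom.fst ℤ ℤ))

/-- `∂_τ = τ⁻¹ (τ ∂_τ)` on `ℂ[x, x⁻¹, τ, τ⁻¹]`. -/
def dtauB : Derivation ℂ Base Base :=
  thetaB • eulerDer ((Int.castAddHom ℂ).comp (AddMonoidHom.snd ℤ ℤ))

/-- `ℂ[x, x⁻¹, τ, τ⁻¹]`, and hence every module over it, is a module over `ℂ[x]`. -/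
instance : Algebra ℂ[X] Base := (aeval (R := ℂ) xB).toAlgebra

/-- `𝒪(U)[x, x⁻¹, τ, τ⁻¹]`, where `U = (ℂ*)ⁿ` has the coordinates `u₁, …, uₙ`. -/
abbrev TorusRing (n : ℕ) : Type := AddMonoidAlgebra Base (Fin n → ℤ)

variable {n : ℕ}

/-- The function `u_j`. -/
def uT (j : Fin n) : TorusRing n := AddMonoidAlgebra.single (Pi.single j 1) 1

/-- The derivation `u_j ∂/∂u_j`. -/
def duT (j : Fin n) : Derivation Base (TorusRing n) (TorusRing n) :=
  eulerDer ((Int.castAddHom Base).comp (Pi.evalAddMonoidHom (fun _ : Fin n => ℤ) j))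

/-- The derivation `∂ₓ`, with `u` and `τ` fixed. -/
def dxT : Derivation ℂ (TorusRing n) (TorusRing n) := coeffDer dxB

/-- The derivation `∂_τ`, with `u` and `x` fixed. -/
def dtauT : Derivation ℂ (TorusRing n) (TorusRing n) := coeffDer dtauB

/-! ### The Gauss-Manin system -/

/-- `u₀ = 1 / (u₁ ^ w₁ ⋯ uₙ ^ wₙ)`. -/
def u0T (w : Fin n → ℕ) : TorusRing n := AddMonoidAlgebra.single (fun j => -(w j : ℤ)) 1

/-- `F = u₁ + ⋯ + uₙ + x / (u₁ ^ w₁ ⋯ uₙ ^ wₙ)`. -/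
def potential (w : Fin n → ℕ) : TorusRing n := ∑ j, uT j + xB • u0T w

/-- The twisted differential `d_u - τ d_u F ∧` from `Ωⁿ⁻¹(U)[x, x⁻¹, τ, τ⁻¹]` to
`Ωⁿ(U)[x, x⁻¹, τ, τ⁻¹]`.

The module of relative `n`-forms is free on `ω₀ = du₁/u₁ ∧ ⋯ ∧ duₙ/uₙ`, so that such a form `h ω₀`
is given by `h`. The module of relative `(n-1)`-forms is free on the contractions `η_j` of `ω₀`
with the vector fields `u_j ∂/∂u_j`, that is
`η_j = (-1)^(j-1) du₁/u₁ ∧ ⋯ (omit j) ⋯ ∧ duₙ/uₙ`, so that such a form `∑ h_j η_j` is given by the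
family `h`. One has `d_u (h η_j) = (u_j ∂h/∂u_j) ω₀` and
`d_u F ∧ h η_j = (u_j ∂F/∂u_j) h ω₀`. -/
def twistedD (w : Fin n → ℕ) : (Fin n → TorusRing n) →ₗ[Base] TorusRing n :=
  ∑ j, ((duT j).toLinearMap -
      tauB • LinearMap.mulLeft Base (duT j (potential w))) ∘ₗ LinearMap.proj j

/-- The image of `d_u - τ d_u F ∧`. -/
def relations (w : Fin n → ℕ) : Submodule Base (TorusRing n) := LinearMap.range (twistedD w)

/-- The (Fourier-Laplace transform of the) Gauss-Manin system `G` of `F`. -/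
abbrev GM (w : Fin n → ℕ) : Type := TorusRing n ⧸ relations w

/-- `∂_τ - F` on forms. -/
def preNablaTau (w : Fin n → ℕ) : TorusRing n →ₗ[ℂ] TorusRing n :=
  dtauT.toLinearMap - LinearMap.mulLeft ℂ (potential w)

/-- `∂ₓ - τ ∂F/∂x` on forms. -/
def preNablaX (w : Fin n → ℕ) : TorusRing n →ₗ[ℂ] TorusRing n :=
  dxT.toLinearMap - LinearMap.mulLeft ℂ (tauB • dxT (potential w))


theorem coeffDer_duT (D : Derivation ℂ Base Base) (j : Fin n) (f : TorusRing n) :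
    coeffDer D (duT j f) = duT j (coeffDer D f) := by
  induction f using AddMonoidAlgebra.induction_linear with
  | zero => simp
  | add f g hf hg => simp only [map_add, hf, hg]
  | single m c => simp [duT, eulerDer_single, coeffDer_single]

theorem coeffDer_smul (D : Derivation ℂ Base Base) (b : Base) (f : TorusRing n) :
    coeffDer D (b • f) = D b • f + b • coeffDer D f := by
  induction f using AddMonoidAlgebra.induction_linear with
  | zero => simp
  | add f g hf hg => simp only [map_add, smul_add, hf, hg]; abel
  | single m c =>
    simp only [AddMonoidAlgebra.smul_single, coeffDer_single, smul_eq_mul, Derivation.leibniz,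
      ← AddMonoidAlgebra.single_add]
    congr 1
    ring

theorem dtauB_tauB : dtauB tauB = 1 := by
  rw [dtauB, Derivation.smul_apply, tauB, eulerDer_single, thetaB, smul_eq_mul,
    AddMonoidAlgebra.single_mul_single]
  simp [AddMonoidAlgebra.one_def, Prod.zero_eq_mk]

theorem dxB_tauB : dxB tauB = 0 := by
  rw [dxB, Derivation.smul_apply, tauB, eulerDer_single]
  simp

theorem dtauB_xB : dtauB xB = 0 := by
  rw [dtauB, Derivation.smul_apply, xB, eulerDer_single]
  simp

theorem dtauT_potential (w : Fin n → ℕ) : dtauT (potential w) = 0 := by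
  simp only [dtauT, potential, map_add, map_sum, coeffDer_smul, dtauB_xB, uT, u0T, coeffDer_single,
    Derivation.map_one_eq_zero]
  simp

theorem twistedD_apply (w : Fin n → ℕ) (h : Fin n → TorusRing n) :
    twistedD w h = ∑ j, (duT j (h j) - tauB • (duT j (potential w) * h j)) := by
  simp [twistedD]

/-- `∂_τ - F` commutes with the twisted differential. -/
theorem preNablaTau_twistedD (w : Fin n → ℕ) (h : Fin n → TorusRing n) :
    preNablaTau w (twistedD w h) = twistedD w fun j => preNablaTau w (h j) := by
  simp only [twistedD_apply, map_sum]
  refine Finset.sum_congr rfl fun j _ => ?_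
  have h1 : dtauT (duT j (potential w)) = 0 := by
    rw [dtauT, coeffDer_duT]
    have := dtauT_potential w
    rw [dtauT] at this
    rw [this, map_zero]
  simp only [preNablaTau, LinearMap.sub_apply, LinearMap.mulLeft_apply,
    Derivation.coeFn_coe, map_sub, Derivation.leibniz, smul_eq_mul]
  have h2 : dtauT (tauB • (duT j (potential w) * h j)) =
      duT j (potential w) * h j + tauB • (duT j (potential w) * dtauT (h j)) := by
    rw [dtauT, coeffDer_smul, dtauB_tauB, one_smul, Derivation.leibniz]
    rw [dtauT] at h1
    simp [h1]
  rw [h2, dtauT, coeffDer_duT]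
  simp only [mul_sub, smul_sub, mul_smul_comm, mul_left_comm (potential w), mul_comm (h j)]
  abel

/-- `∂ₓ - τ ∂F/∂x` commutes with the twisted differential. -/
theorem preNablaX_twistedD (w : Fin n → ℕ) (h : Fin n → TorusRing n) :
    preNablaX w (twistedD w h) = twistedD w fun j => preNablaX w (h j) := by
  simp only [twistedD_apply, map_sum]
  refine Finset.sum_congr rfl fun j _ => ?_
  have h1 : dxT (tauB • (duT j (potential w) * h j)) =
      tauB • (duT j (dxT (potential w)) * h j) + tauB • (duT j (potential w) * dxT (h j)) := by
    rw [dxT, coeffDer_smul, dxB_tauB, zero_smul, Derivation.leibniz, coeffDer_duT]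
    simp only [smul_eq_mul, zero_add, smul_add]
    rw [mul_comm (h j), add_comm]
  simp only [preNablaX, LinearMap.sub_apply, LinearMap.mulLeft_apply,
    Derivation.coeFn_coe, map_sub, h1, Derivation.leibniz, smul_eq_mul, Derivation.map_smul]
  rw [dxT, coeffDer_duT]
  simp only [mul_sub, smul_sub, mul_smul_comm, smul_mul_assoc,
    mul_left_comm (coeffDer dxB (potential w)), mul_comm (h j)]
  abel

/-- The operator on `G` induced by an operator on forms which commutes with the twisted
differential. -/
def descend (w : Fin n → ℕ) (T : TorusRing n →ₗ[ℂ] TorusRing n)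
    (hT : ∀ h, T (twistedD w h) = twistedD w fun j => T (h j)) : GM w →ₗ[ℂ] GM w :=
  (Submodule.Quotient.restrictScalarsEquiv ℂ (relations w)).toLinearMap ∘ₗ
    Submodule.mapQ ((relations w).restrictScalars ℂ) ((relations w).restrictScalars ℂ) T (by
      rintro _ ⟨h, rfl⟩
      exact ⟨_, (hT h).symm⟩) ∘ₗ
    (Submodule.Quotient.restrictScalarsEquiv ℂ (relations w)).symm.toLinearMap

/-- `∇_{∂_τ}` on `G`, that is `∇_{∂_τ}(ω τ ^ i) = i ω τ ^ (i - 1) - F ω τ ^ i`. -/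
def nablaTau (w : Fin n → ℕ) : GM w →ₗ[ℂ] GM w :=
  descend w (preNablaTau w) (preNablaTau_twistedD w)

/-- `∇_{∂ₓ}` on `G`, that is `∇_{∂ₓ}(ω τ ^ i) = (∂ω/∂x) τ ^ i - (∂F/∂x) ω τ ^ (i + 1)`. -/
def nablaX (w : Fin n → ℕ) : GM w →ₗ[ℂ] GM w :=
  descend w (preNablaX w) (preNablaX_twistedD w)

/-- `∇_{∂_θ} = - τ² ∇_{∂_τ}` on `G`, as `θ = τ⁻¹`. -/
def nablaTheta (w : Fin n → ℕ) (s : GM w) : GM w := -(tauB ^ 2 • nablaTau w s)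

/-! ### The sections `ω_k^φ` and the lattices -/

/-- The number `μ = 1 + w₁ + ⋯ + wₙ`. -/
def milnor (w : Fin n → ℕ) : ℕ := 1 + ∑ i, w i

/-- The disjoint union of the sets `{ℓ μ / w_i | 0 ≤ ℓ < w_i}` for `i = 0, …, n`, where `w₀ = 1`. -/
def spectrumSet (w : Fin n → ℕ) : Multiset ℚ :=
  {0} + ∑ i, (Multiset.range (w i)).map fun l => (l : ℚ) * milnor w / w i

/-- The numbers `s₀ ≤ s₁ ≤ ⋯ ≤ s_{μ-1}`: the elements of the above multiset in increasing order. -/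
def sNum (w : Fin n → ℕ) (k : ℕ) : ℚ := ((spectrumSet w).sort (· ≤ ·)).getD k 0

/-- `α_k = k - s_k`. -/
def alpha (w : Fin n → ℕ) (k : ℕ) : ℚ := k - sNum w k

/-- The sections `ω_k^φ` of `G`: `ω₀^φ` is the class of `du₁/u₁ ∧ ⋯ ∧ duₙ/uₙ`, and
`-(1/μ) (τ ∇_{∂_τ} + α_k) ω_k^φ = τ ω_{k+1}^φ`. -/
def omega (w : Fin n → ℕ) : ℕ → GM w
  | 0 => Submodule.Quotient.mk 1
  | k + 1 => (-(1 / (milnor w : ℂ))) •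
      thetaB • (tauB • nablaTau w (omega w k) + ((alpha w k : ℚ) : ℂ) • omega w k)

/-- Multiplication by `b ∈ ℂ[x, x⁻¹, τ, τ⁻¹]` on `G`, as a `ℂ[x]`-linear map. -/
def mulGM (w : Fin n → ℕ) (b : Base) : GM w →ₗ[ℂ[X]] GM w :=
  (LinearMap.lsmul Base (GM w) b).restrictScalars ℂ[X]

/-- The `ℂ[x, t]`-submodule of `G` generated by `ω₀^φ, …, ω_{μ-1}^φ`, viewed as a `ℂ[x]`-module:
it is spanned over `ℂ[x]` by the `t ^ i ω_k^φ`, `i ≥ 0`. -/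
def lattice (w : Fin n → ℕ) (t : Base) : Submodule ℂ[X] (GM w) :=
  Submodule.span ℂ[X]
    (Set.range fun p : ℕ × Fin (milnor w) => t ^ p.1 • omega w (p.2 : ℕ))

/-- The fibre `L / t L` of the above lattice at `t = 0`. -/
abbrev Fibre (w : Fin n → ℕ) (t : Base) : Type :=
  lattice w t ⧸ ((lattice w t).map (mulGM w t)).submoduleOf (lattice w t)

/-- `y ∈ G` lies in the lattice `L`, and its class in `L / t L` is `e`. -/
def HasClass (w : Fin n → ℕ) (t : Base) (y : GM w) (e : Fibre w t) : Prop :=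
  ∃ h : y ∈ lattice w t, (Submodule.Quotient.mk ⟨y, h⟩ : Fibre w t) = e

/-- The class `[ω_k^φ]` in `L / t L`. -/
def cls (w : Fin n → ℕ) (t : Base) (k : Fin (milnor w)) : Fibre w t :=
  Submodule.Quotient.mk ⟨omega w k, Submodule.subset_span ⟨(0, k), by simp⟩⟩

/-- `E^log = L₀^φ / θ L₀^φ`, where `L₀^φ` is the `ℂ[x, θ]`-module generated by the `ω_k^φ`. -/
abbrev Elog (w : Fin n → ℕ) : Type := Fibre w thetaB

/-- `E_∞ = L_∞^φ / τ L_∞^φ`, where `L_∞^φ` is the `ℂ[x, τ]`-module generated by the `ω_k^φ`. -/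
abbrev Einf (w : Fin n → ℕ) : Type := Fibre w tauB

/-! ### Frobenius type structures with logarithmic pole along `x = 0` -/

/-- `Der(log {x = 0})`: the derivations of `ℂ[x]` which preserve the ideal `(x)`. -/
def LogDer : Submodule ℂ[X] (Derivation ℂ ℂ[X] ℂ[X]) where
  carrier := {ξ | X ∣ ξ X}
  zero_mem' := by simp
  add_mem' := fun h₁ h₂ => by simpa using dvd_add h₁ h₂
  smul_mem' := fun c _ h => by simpa using Dvd.dvd.mul_left h c

theorem lie_mem_logDer (ξ η : LogDer) : ⁅(ξ : Derivation ℂ ℂ[X] ℂ[X]), (η : Derivation ℂ ℂ[X] ℂ[X])⁆ ∈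
    LogDer := by
  obtain ⟨a, ha⟩ := ξ.2
  obtain ⟨b, hb⟩ := η.2
  change X ∣ ⁅(ξ : Derivation ℂ ℂ[X] ℂ[X]), (η : Derivation ℂ ℂ[X] ℂ[X])⁆ X
  rw [Derivation.commutator_apply, ha, hb, Derivation.leibniz, Derivation.leibniz, ha, hb]
  exact ⟨(ξ : Derivation ℂ ℂ[X] ℂ[X]) b - (η : Derivation ℂ ℂ[X] ℂ[X]) a, by
    simp only [smul_eq_mul]; ring⟩

/-- The Lie bracket of logarithmic vector fields. -/
def logLie (ξ η : LogDer) : LogDer := ⟨_, lie_mem_logDer ξ η⟩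

/-- Two endomorphisms `R₀`, `R_∞` of a `ℂ[x]`-module `E`, a `ℂ[x]`-linear map
`Φ : E → Ω¹(log {x = 0}) ⊗ E` and a connection `▽ : E → Ω¹(log {x = 0}) ⊗ E` with logarithmic pole
along `x = 0`. As `Ω¹(log {x = 0})` is the dual of the free module `Der(log {x = 0})`, the last two
are given by the endomorphisms `Φ_ξ` and `▽_ξ` for `ξ ∈ Der(log {x = 0})`. -/
@[ext]
structure LogFrobeniusData (E : Type*) [AddCommGroup E] [Module ℂ[X] E] where
  R0 : Module.End ℂ[X] E
  Rinf : Module.End ℂ[X] E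
  Phi : LogDer →ₗ[ℂ[X]] Module.End ℂ[X] E
  conn : LogDer →ₗ[ℂ[X]] (E →+ E)
  leibniz : ∀ (ξ : LogDer) (f : ℂ[X]) (e : E), conn ξ (f • e) = ξ.1 f • e + f • conn ξ e

/-- `(E, R₀, R_∞, Φ, ▽)` is a Frobenius type structure without metric, with logarithmic pole along
`x = 0`. -/
structure IsLogFrobeniusTypeWithoutMetric {E : Type*} [AddCommGroup E] [Module ℂ[X] E]
    (D : LogFrobeniusData E) : Prop where
  free : Module.Free ℂ[X] E
  finite : Module.Finite ℂ[X] E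
  /-- `▽² = 0` -/
  conn_flat : ∀ ξ η e,
    D.conn ξ (D.conn η e) - D.conn η (D.conn ξ e) = D.conn (logLie ξ η) e
  /-- `▽(R_∞) = 0` -/
  conn_Rinf : ∀ ξ e, D.conn ξ (D.Rinf e) - D.Rinf (D.conn ξ e) = 0
  /-- `Φ ∧ Φ = 0` -/
  Phi_wedge_Phi : ∀ ξ η, D.Phi ξ * D.Phi η - D.Phi η * D.Phi ξ = 0
  /-- `[R₀, Φ] = 0` -/
  R0_Phi : ∀ ξ, D.R0 * D.Phi ξ - D.Phi ξ * D.R0 = 0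
  /-- `▽(Φ) = 0` -/
  conn_Phi : ∀ ξ η e,
    (D.conn ξ (D.Phi η e) - D.Phi η (D.conn ξ e)) - (D.conn η (D.Phi ξ e) - D.Phi ξ (D.conn η e))
      = D.Phi (logLie ξ η) e
  /-- `▽(R₀) + Φ = [Φ, R_∞]` -/
  conn_R0 : ∀ ξ e,
    (D.conn ξ (D.R0 e) - D.R0 (D.conn ξ e)) + D.Phi ξ e = D.Phi ξ (D.Rinf e) - D.Rinf (D.Phi ξ e)

/-- The symmetric bilinear form `g` satisfies all the relations of a metric of a Frobenius type
structure, non-degeneracy being left aside. -/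
structure IsCompatibleForm {E : Type*} [AddCommGroup E] [Module ℂ[X] E]
    (D : LogFrobeniusData E) (g : LinearMap.BilinForm ℂ[X] E) : Prop where
  symm : ∀ a b, g a b = g b a
  /-- `▽(g) = 0` -/
  flat : ∀ (ξ : LogDer) (a b : E), ξ.1 (g a b) = g (D.conn ξ a) b + g a (D.conn ξ b)
  /-- `Φ* = Φ` -/
  Phi_adj : ∀ ξ a b, g (D.Phi ξ a) b = g a (D.Phi ξ b)
  /-- `R₀* = R₀` -/
  R0_adj : ∀ a b, g (D.R0 a) b = g a (D.R0 b)
  /-- `R_∞ + R_∞* = r Id` for a constant `r` -/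
  Rinf_adj : ∃ r : ℂ, ∀ a b, g (D.Rinf a) b + g a (D.Rinf b) = C r * g a b

/-- A bilinear form on a `ℂ[x]`-module is non-degenerate (as a metric on the corresponding bundle)
if it induces an isomorphism from `E` to its dual. -/
def IsNondegenerate {E : Type*} [AddCommGroup E] [Module ℂ[X] E]
    (g : LinearMap.BilinForm ℂ[X] E) : Prop :=
  Function.Bijective (g : E → Module.Dual ℂ[X] E)

/-- `(E, R₀, R_∞, Φ, ▽, g)` is a Frobenius type structure with logarithmic pole along `x = 0`. -/
structure IsLogFrobeniusType {E : Type*} [AddCommGroup E] [Module ℂ[X] E]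
    (D : LogFrobeniusData E) (g : LinearMap.BilinForm ℂ[X] E) : Prop where
  withoutMetric : IsLogFrobeniusTypeWithoutMetric D
  compatible : IsCompatibleForm D g
  nondegenerate : IsNondegenerate g

/-! ### The data induced on `E^log` -/

/-- `∇_ξ = ξ(x) ∇_{∂ₓ}` on `G`, for a logarithmic vector field `ξ`. -/
def nablaLog (w : Fin n → ℕ) (ξ : LogDer) (s : GM w) : GM w := (ξ.1 X) • nablaX w s

/-- The coefficient of `θ ^ n` in `S(ω_i^φ, ω_j^φ)`: it is `1` if `i, j ≤ n` and `i + j = n`,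
`c x` if `i, j ≥ n + 1` and `i + j = μ + n`, where `c = ∏ w_i ^ (- w_i)`, and `0` otherwise. -/
def gram (w : Fin n → ℕ) (i j : Fin (milnor w)) : ℂ[X] :=
  if (i : ℕ) + j = n then 1
  else if n + 1 ≤ (i : ℕ) ∧ n + 1 ≤ (j : ℕ) ∧ (i : ℕ) + j = milnor w + n then
    C (∏ l, ((w l : ℂ) ^ w l)⁻¹) * X
  else 0

/-- The data `(R₀, R_∞, Φ, ▽, g)` on `E^log` are those induced by `∇` and `S`. -/
structure IsInduced (w : Fin n → ℕ) (D : LogFrobeniusData (Elog w))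
    (g : LinearMap.BilinForm ℂ[X] (Elog w)) : Prop where
  /-- `R₀[ω_k^φ] = [θ² ∇_{∂_θ} ω_k^φ]` -/
  R0 : ∀ k : Fin (milnor w),
    HasClass w thetaB (thetaB ^ 2 • nablaTheta w (omega w k)) (D.R0 (cls w thetaB k))
  /-- `Φ_ξ[ω_k^φ] = [θ ∇_ξ ω_k^φ]` -/
  Phi : ∀ (ξ : LogDer) (k : Fin (milnor w)),
    HasClass w thetaB (thetaB • nablaLog w ξ (omega w k)) (D.Phi ξ (cls w thetaB k))
  /-- `R_∞[ω_k^φ] = [∇_{τ ∂_τ} ω_k^φ]` and `▽_ξ[ω_k^φ] = [∇_ξ ω_k^φ]`, with classes in `E_∞`, for the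
  canonical identification `ι` of `E^log` with `E_∞`. -/
  Rinf_conn : ∃ ι : Elog w ≃ₗ[ℂ[X]] Einf w,
    (∀ k, ι (cls w thetaB k) = cls w tauB k) ∧
    (∀ k : Fin (milnor w),
      HasClass w tauB (tauB • nablaTau w (omega w k)) (ι (D.Rinf (cls w thetaB k)))) ∧
    (∀ (ξ : LogDer) (k : Fin (milnor w)),
      HasClass w tauB (nablaLog w ξ (omega w k)) (ι (D.conn ξ (cls w thetaB k))))
  /-- `g([ω_i^φ], [ω_j^φ]) = θ ^ (-n) S(ω_i^φ, ω_j^φ)` -/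
  g : ∀ i j, g (cls w thetaB i) (cls w thetaB j) = gram w i j

end GaussManin

end

noncomputable section

namespace GaussManin

variable {n : ℕ}

/-! ### Derivations of the base and the operators on `G` -/

/-! Everything is computed on the sections `ω_k = omega w k`. Their recursion says `τ∇_τ ω_k = -(α_k
ω_k + μ τ ω_{k+1})` (`eulerTau_omega`). Quasi-homogeneity of `F` gives `μ x∇_x ω_k = τ∇_τ ω_k + k
ω_k`, hence `x∇_x ω_k = (s_k/μ) ω_k - τ ω_{k+1}` (`eulerX_omega`). The system closes up after `μ`
steps through `ω_μ = c x ω_0` (`omega_milnor`).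

Let `N` be the shift `ω_k ↦ ω_{k+1}`, with `ω_{μ-1} ↦ c x ω_0`. Modulo `θ` only the shift survives:
`R_0 = μ N` and `Φ = -N` along `x∂_x`. Modulo `τ` only the diagonal survives: `R_∞ = diag(-α_k)`,
and the connection along `x∂_x` has residues `s_k/μ`. This is `modelData`. The relations (a) hold
because `N` sends each basis vector to an eigenvector of both diagonal operators, the wrapped vector
`c x ω_0` having residue 1. The relations (b) come from `s_k = 0` for `k ≤ n` and from the symmetry
`s_i + s_j = μ` for `i, j ≥ n+1`, `i + j = μ + n` (`sNum_add_sNum`).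

These formulas determine the data once the classes of the `ω_k` are bases of both fibres, that is,
once the `t^i ω_k` are independent over `ℂ[x]` for `t = θ` and `t = τ`. Independence is tested by
the Mellin transform in `x` of the oscillating integrals of `exp(-τF)`, a product of Gamma
functions. Divided by the period of `ω_0`, the period of `x^j ω_k` is a polynomial of degree `μj +
k` in the Mellin exponent. Each degree occurs exactly once for `k < μ`, so these polynomials form a
basis of `ℂ[X]`, and the grading by powers of `τ` separates the powers of `t`. -/

theorem tauB_thetaB : tauB * thetaB = 1 := by
  simp [tauB, thetaB, AddMonoidAlgebra.single_mul_single, AddMonoidAlgebra.one_def,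
    Prod.zero_eq_mk]

theorem thetaB_tauB : thetaB * tauB = 1 := by rw [mul_comm, tauB_thetaB]

theorem dtauB_thetaB : dtauB thetaB = -thetaB ^ 2 := by
  rw [dtauB, Derivation.smul_apply, thetaB, eulerDer_single, sq, smul_eq_mul,
    AddMonoidAlgebra.single_mul_single, AddMonoidAlgebra.single_mul_single]
  simp

theorem dxB_xB : dxB xB = 1 := by
  rw [dxB, Derivation.smul_apply, xB, eulerDer_single, smul_eq_mul,
    AddMonoidAlgebra.single_mul_single]
  simp [AddMonoidAlgebra.one_def, Prod.zero_eq_mk]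

theorem dxB_thetaB : dxB thetaB = 0 := by
  rw [dxB, Derivation.smul_apply, thetaB, eulerDer_single]
  simp

theorem nablaTau_mk (w : Fin n → ℕ) (s : TorusRing n) :
    nablaTau w (Submodule.Quotient.mk s) =
      (Submodule.Quotient.mk (dtauT s - potential w * s) : GM w) := rfl

theorem nablaX_mk (w : Fin n → ℕ) (s : TorusRing n) :
    nablaX w (Submodule.Quotient.mk s) =
      (Submodule.Quotient.mk (dxT s - tauB • dxT (potential w) * s) : GM w) := rfl

theorem nablaTau_smul (w : Fin n → ℕ) (b : Base) (y : GM w) :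
    nablaTau w (b • y) = dtauB b • y + b • nablaTau w y := by
  obtain ⟨s, rfl⟩ := Submodule.Quotient.mk_surjective _ y
  simp only [← Submodule.Quotient.mk_smul, nablaTau_mk, ← Submodule.Quotient.mk_add]
  congr 1
  rw [dtauT, coeffDer_smul, smul_sub, mul_smul_comm]
  abel

theorem nablaX_smul (w : Fin n → ℕ) (b : Base) (y : GM w) :
    nablaX w (b • y) = dxB b • y + b • nablaX w y := by
  obtain ⟨s, rfl⟩ := Submodule.Quotient.mk_surjective _ y
  simp only [← Submodule.Quotient.mk_smul, nablaX_mk, ← Submodule.Quotient.mk_add]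
  congr 1
  rw [dxT, coeffDer_smul, smul_sub, mul_smul_comm]
  abel

/-- The operator `τ ∇_{∂_τ}` on `G`. -/
def eulerTau (w : Fin n → ℕ) : Module.End ℂ (GM w) :=
  (LinearMap.lsmul Base (GM w) tauB).restrictScalars ℂ ∘ₗ nablaTau w

theorem eulerTau_apply (w : Fin n → ℕ) (y : GM w) : eulerTau w y = tauB • nablaTau w y := rfl

/-- The operator `x ∇_{∂ₓ}` on `G`. -/
def eulerX (w : Fin n → ℕ) : Module.End ℂ (GM w) :=
  (LinearMap.lsmul Base (GM w) xB).restrictScalars ℂ ∘ₗ nablaX w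

theorem eulerX_apply (w : Fin n → ℕ) (y : GM w) : eulerX w y = xB • nablaX w y := rfl

theorem eulerTau_smul (w : Fin n → ℕ) (b : Base) (y : GM w) :
    eulerTau w (b • y) = (tauB * dtauB b) • y + b • eulerTau w y := by
  simp only [eulerTau_apply, nablaTau_smul, smul_add, smul_smul, mul_comm]

theorem eulerX_smul (w : Fin n → ℕ) (b : Base) (y : GM w) :
    eulerX w (b • y) = (xB * dxB b) • y + b • eulerX w y := by
  simp only [eulerX_apply, nablaX_smul, smul_add, smul_smul, mul_comm]

theorem eulerTau_tau_smul (w : Fin n → ℕ) (y : GM w) :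
    eulerTau w (tauB • y) = tauB • y + tauB • eulerTau w y := by
  rw [eulerTau_smul, dtauB_tauB, mul_one]

theorem eulerTau_theta_smul (w : Fin n → ℕ) (y : GM w) :
    eulerTau w (thetaB • y) = -(thetaB • y) + thetaB • eulerTau w y := by
  rw [eulerTau_smul, dtauB_thetaB, mul_neg, sq, ← mul_assoc, tauB_thetaB, one_mul, neg_smul]

theorem eulerTau_x_smul (w : Fin n → ℕ) (y : GM w) :
    eulerTau w (xB • y) = xB • eulerTau w y := by
  rw [eulerTau_smul, dtauB_xB, mul_zero, zero_smul, zero_add]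

theorem eulerTau_tau_pow_smul (w : Fin n → ℕ) (k : ℕ) (y : GM w) :
    eulerTau w (tauB ^ k • y) = (k : ℂ) • tauB ^ k • y + tauB ^ k • eulerTau w y := by
  induction k with
  | zero => simp
  | succ k ih =>
    rw [pow_succ', mul_smul, eulerTau_tau_smul, ih, smul_add, mul_smul, Nat.cast_succ, add_smul,
      one_smul, smul_comm tauB (k : ℂ)]
    abel

theorem eulerX_tau_smul (w : Fin n → ℕ) (y : GM w) :
    eulerX w (tauB • y) = tauB • eulerX w y := by
  rw [eulerX_smul, dxB_tauB, mul_zero, zero_smul, zero_add]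

theorem eulerX_theta_smul (w : Fin n → ℕ) (y : GM w) :
    eulerX w (thetaB • y) = thetaB • eulerX w y := by
  rw [eulerX_smul, dxB_thetaB, mul_zero, zero_smul, zero_add]

/-! ### Action of the two Euler operators on monomial forms. -/

/-- The class of the form `u ^ m ω₀`. -/
def monomialClass (w : Fin n → ℕ) (m : Fin n → ℤ) : GM w :=
  Submodule.Quotient.mk (AddMonoidAlgebra.single m 1)

theorem monomialClass_zero (w : Fin n → ℕ) : monomialClass w 0 = omega w 0 := rfl

theorem mk_single (w : Fin n → ℕ) (m : Fin n → ℤ) (b : Base) :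
    (Submodule.Quotient.mk (AddMonoidAlgebra.single m b) : GM w) = b • monomialClass w m := by
  rw [monomialClass, ← Submodule.Quotient.mk_smul, AddMonoidAlgebra.smul_single, smul_eq_mul,
    mul_one]

/-- Exponents of the monomial `u₀`. -/
def u0Exp (w : Fin n → ℕ) : Fin n → ℤ := fun j => -(w j : ℤ)

theorem potential_mul_single (w : Fin n → ℕ) (m : Fin n → ℤ) (b : Base) :
    potential w * AddMonoidAlgebra.single m b =
      ∑ j, AddMonoidAlgebra.single (m + Pi.single j 1) b +
        AddMonoidAlgebra.single (m + u0Exp w) (xB * b) := by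
  simp only [potential, add_mul, Finset.sum_mul, uT, u0T, AddMonoidAlgebra.smul_single,
    AddMonoidAlgebra.single_mul_single, one_mul, smul_eq_mul, mul_one, add_comm m]
  rfl

theorem duT_potential (w : Fin n → ℕ) (j : Fin n) :
    duT j (potential w) = uT j - (w j : ℂ) • xB • u0T w := by
  rw [potential, map_add, map_sum, Finset.sum_eq_single j]
  · rw [Derivation.map_smul, u0T, duT, eulerDer_single, uT, eulerDer_single]
    simp only [AddMonoidHom.comp_apply, Pi.evalAddMonoidHom_apply, Pi.single_eq_same,
      Int.coe_castAddHom, Int.cast_one, mul_one, Int.cast_neg, Int.cast_natCast,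
      AddMonoidAlgebra.smul_single, sub_eq_add_neg, ← AddMonoidAlgebra.single_neg]
    congr 2
    rw [smul_eq_mul, smul_eq_mul, mul_one, mul_neg, mul_comm, ← nsmul_eq_mul,
      Nat.cast_smul_eq_nsmul]
  · intro i _ hij
    rw [uT, duT, eulerDer_single]
    simp [hij.symm]
  · simp

theorem dxT_potential (w : Fin n → ℕ) : dxT (potential w) = u0T w := by
  rw [potential, map_add, map_sum, Finset.sum_eq_zero, zero_add, dxT, coeffDer_smul, dxB_xB,
    u0T, coeffDer_single]
  · simp
  · intro i _
    rw [uT, dxT, coeffDer_single]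
    simp

/-- The monomial form of the relations defining `G`. -/
theorem twistedD_single (w : Fin n → ℕ) (j : Fin n) (m : Fin n → ℤ) (b : Base) :
    twistedD w (Pi.single j (AddMonoidAlgebra.single m b)) =
      AddMonoidAlgebra.single m ((m j : ℂ) • b)
        - AddMonoidAlgebra.single (m + Pi.single j 1) (tauB * b)
        + AddMonoidAlgebra.single (m + u0Exp w) ((w j : ℂ) • (tauB * xB * b)) := by
  rw [twistedD_apply, Finset.sum_eq_single j]
  · rw [Pi.single_eq_same, duT_potential, duT, eulerDer_single, sub_mul, smul_sub, uT, u0T,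
      AddMonoidAlgebra.single_mul_single, smul_mul_assoc, smul_mul_assoc,
      AddMonoidAlgebra.single_mul_single, sub_sub_eq_add_sub, add_sub_right_comm]
    simp only [one_mul, AddMonoidAlgebra.smul_single, add_comm m]
    have h1 : (((Int.castAddHom Base).comp (Pi.evalAddMonoidHom (fun _ : Fin n => ℤ) j)) m) * b =
        (m j : ℂ) • b := by
      simp [Algebra.smul_def]
    have h2 : tauB • (w j : ℂ) • xB • b = (w j : ℂ) • (tauB * xB * b) := by
      rw [smul_comm, smul_eq_mul, smul_eq_mul, mul_assoc]
    rw [h1, h2]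
    rfl
  · intro i _ hij
    simp [hij]
  · simp

theorem tau_smul_monomialClass (w : Fin n → ℕ) (j : Fin n) (m : Fin n → ℤ) :
    tauB • monomialClass w (m + Pi.single j 1) =
      (m j : ℂ) • monomialClass w m + (w j : ℂ) • tauB • xB • monomialClass w (m + u0Exp w) := by
  have h : (Submodule.Quotient.mk
      (twistedD w (Pi.single j (AddMonoidAlgebra.single m 1))) : GM w) = 0 :=
    (Submodule.Quotient.mk_eq_zero _).2 ⟨_, rfl⟩
  rw [twistedD_single, Submodule.Quotient.mk_add, Submodule.Quotient.mk_sub, mk_single, mk_single,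
    mk_single, mul_one, mul_one, smul_assoc, one_smul, smul_assoc, mul_smul] at h
  rw [← sub_eq_zero, ← neg_eq_zero, ← h]
  abel

theorem milnor_cast (w : Fin n → ℕ) : (milnor w : ℂ) = 1 + ∑ i, (w i : ℂ) := by
  simp [milnor]

theorem milnor_ne_zero (w : Fin n → ℕ) : (milnor w : ℂ) ≠ 0 := by
  rw [Nat.cast_ne_zero, milnor]; omega

theorem milnor_pos (w : Fin n → ℕ) : 0 < milnor w := by
  rw [milnor]; omega

/-- The relation `tau_smul_monomialClass` trades each `τ u_j` for `w_j τ x u_0`. Summed over all the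
terms of `τF`, the coefficient of `τ x u_0` becomes `1 + ∑ w_j = μ`. -/
theorem eulerTau_monomialClass (w : Fin n → ℕ) (m : Fin n → ℤ) :
    eulerTau w (monomialClass w m) =
      -((∑ j, (m j : ℂ)) • monomialClass w m +
        (milnor w : ℂ) • tauB • xB • monomialClass w (m + u0Exp w)) := by
  rw [eulerTau_apply, monomialClass, nablaTau_mk, dtauT, coeffDer_single,
    Derivation.map_one_eq_zero, AddMonoidAlgebra.single_zero, zero_sub, potential_mul_single,
    Submodule.Quotient.mk_neg, Submodule.Quotient.mk_add, smul_neg, smul_add]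
  have h : (Submodule.Quotient.mk
      (∑ j, AddMonoidAlgebra.single (m + Pi.single j 1) (1 : Base)) : GM w) =
      ∑ j, monomialClass w (m + Pi.single j 1) :=
    map_sum (Submodule.mkQ _) _ _
  rw [h, Finset.smul_sum, mk_single, mul_one, milnor_cast]
  simp only [tau_smul_monomialClass, Finset.sum_add_distrib, ← Finset.sum_smul, add_smul, one_smul]
  change -(_ • monomialClass w m + _ + _) = -(_ • monomialClass w m + _)
  abel

/-- `τ ∇_{∂_τ}` on monomials, in terms of the multiplication by a coordinate. -/
theorem eulerTau_monomialClass' (w : Fin n → ℕ) (j : Fin n) (hw : 0 < w j) (m : Fin n → ℤ) :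
    eulerTau w (monomialClass w m) =
      ((milnor w : ℂ) / w j * m j - ∑ j, (m j : ℂ)) • monomialClass w m
        - ((milnor w : ℂ) / w j) • tauB • monomialClass w (m + Pi.single j 1) := by
  have h0 : (w j : ℂ) ≠ 0 := Nat.cast_ne_zero.2 hw.ne'
  rw [eulerTau_monomialClass, tau_smul_monomialClass, smul_add,
    smul_smul ((milnor w : ℂ) / w j) (m j : ℂ), smul_smul ((milnor w : ℂ) / w j) (w j : ℂ),
    div_mul_cancel₀ _ h0, sub_smul]
  abel

theorem nablaX_monomialClass (w : Fin n → ℕ) (m : Fin n → ℤ) :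
    nablaX w (monomialClass w m) = -(tauB • monomialClass w (m + u0Exp w)) := by
  rw [monomialClass, nablaX_mk, dxT_potential, dxT, coeffDer_single, Derivation.map_one_eq_zero,
    AddMonoidAlgebra.single_zero, zero_sub, u0T, smul_mul_assoc,
    AddMonoidAlgebra.single_mul_single, Submodule.Quotient.mk_neg, Submodule.Quotient.mk_smul,
    one_mul, add_comm m]
  rfl

theorem eulerX_omega_zero (w : Fin n → ℕ) :
    (milnor w : ℂ) • eulerX w (omega w 0) = eulerTau w (omega w 0) := by
  rw [← monomialClass_zero, eulerX_apply, nablaX_monomialClass, eulerTau_monomialClass]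
  simp [smul_comm xB]

theorem induction_monomialClass {w : Fin n → ℕ} {P : GM w → Prop} (y : GM w)
    (add : ∀ y z, P y → P z → P (y + z))
    (monomial : ∀ b m, P ((b : Base) • monomialClass w m)) : P y := by
  obtain ⟨s, rfl⟩ := Submodule.Quotient.mk_surjective _ y
  induction s using AddMonoidAlgebra.induction_linear with
  | zero => simpa using monomial 0 0
  | add f g hf hg => exact add _ _ hf hg
  | single m b => rw [mk_single]; exact monomial b m

theorem eulerDer_comm {k M : Type*} [CommRing k] [AddCommMonoid M] (ℓ ℓ' : M →+ k)
    (a : AddMonoidAlgebra k M) : eulerDer ℓ (eulerDer ℓ' a) = eulerDer ℓ' (eulerDer ℓ a) := by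
  induction a using AddMonoidAlgebra.induction_linear with
  | zero => simp
  | add f g hf hg => simp only [map_add, hf, hg]
  | single m c => simp only [eulerDer_single, mul_left_comm]

theorem tauB_mul_dtauB (b : Base) :
    tauB * dtauB b = eulerDer ((Int.castAddHom ℂ).comp (AddMonoidHom.snd ℤ ℤ)) b := by
  rw [dtauB, Derivation.smul_apply, smul_eq_mul, ← mul_assoc, tauB_thetaB, one_mul]

theorem xB_mul_dxB (b : Base) :
    xB * dxB b = eulerDer ((Int.castAddHom ℂ).comp (AddMonoidHom.fst ℤ ℤ)) b := by
  rw [dxB, Derivation.smul_apply, smul_eq_mul, ← mul_assoc, xB,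
    AddMonoidAlgebra.single_mul_single]
  simp [← Prod.zero_eq_mk, ← AddMonoidAlgebra.one_def]

/-- Flatness of the Gauss-Manin connection, checked on monomials. The coefficients agree because the
exponents of `u_0` add up to `1 - μ`. -/
theorem eulerX_eulerTau (w : Fin n → ℕ) (y : GM w) :
    eulerX w (eulerTau w y) = eulerTau w (eulerX w y) := by
  induction y using induction_monomialClass with
  | add y z hy hz => simp only [map_add, hy, hz]
  | monomial b m =>
    have h : eulerX w (eulerTau w (monomialClass w m)) =
        eulerTau w (eulerX w (monomialClass w m)) := by
      have hX (m : Fin n → ℤ) : eulerX w (monomialClass w m) =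
          -(tauB • xB • monomialClass w (m + u0Exp w)) := by
        rw [eulerX_apply, nablaX_monomialClass, smul_neg, smul_comm]
      have hs : ∑ j, ((m + u0Exp w) j : ℂ) = ∑ j, (m j : ℂ) + 1 - milnor w := by
        simp [u0Exp, Finset.sum_add_distrib, milnor_cast]
        ring
      have h1 : eulerTau w (eulerX w (monomialClass w m)) =
          -(tauB • xB • monomialClass w (m + u0Exp w) -
            ((∑ j, (m j : ℂ) + 1 - milnor w) • tauB • xB • monomialClass w (m + u0Exp w) +
              (milnor w : ℂ) • tauB • xB • tauB • xB •
                monomialClass w (m + u0Exp w + u0Exp w))) := by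
        rw [hX, map_neg, eulerTau_tau_smul, eulerTau_x_smul, eulerTau_monomialClass, hs, smul_neg,
          smul_neg, ← sub_eq_add_neg, smul_add, smul_add, smul_comm xB (_ : ℂ),
          smul_comm tauB (_ : ℂ), smul_comm xB (milnor w : ℂ), smul_comm tauB (milnor w : ℂ)]
      have h2 : eulerX w (eulerTau w (monomialClass w m)) =
          -(-((∑ j, (m j : ℂ)) • tauB • xB • monomialClass w (m + u0Exp w)) +
              (milnor w : ℂ) • (tauB • xB • monomialClass w (m + u0Exp w) -
                tauB • xB • tauB • xB • monomialClass w (m + u0Exp w + u0Exp w))) := by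
        rw [eulerTau_monomialClass, map_neg, map_add, map_smul, map_smul, hX, eulerX_tau_smul,
          eulerX_smul, dxB_xB, hX, mul_one, smul_neg, smul_neg, ← sub_eq_add_neg, smul_sub]
      rw [h1, h2]
      generalize tauB • xB • tauB • xB • monomialClass w (m + u0Exp w + u0Exp w) = B
      generalize tauB • xB • monomialClass w (m + u0Exp w) = A
      rw [add_sub_assoc, add_smul, sub_smul, one_smul, smul_sub]
      abel
    simp only [eulerTau_smul, eulerX_smul, map_add, h, tauB_mul_dtauB, xB_mul_dxB]
    rw [eulerDer_comm]
    abel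

/-! ### The connection in terms of the sections `ω_k`. -/

theorem omega_succ (w : Fin n → ℕ) (k : ℕ) :
    omega w (k + 1) = (-(1 / (milnor w : ℂ))) •
      thetaB • (eulerTau w (omega w k) + ((alpha w k : ℚ) : ℂ) • omega w k) := rfl

theorem eulerTau_omega (w : Fin n → ℕ) (k : ℕ) :
    eulerTau w (omega w k) =
      -(((alpha w k : ℚ) : ℂ) • omega w k + (milnor w : ℂ) • tauB • omega w (k + 1)) := by
  rw [omega_succ, smul_comm tauB, smul_smul, smul_smul, tauB_thetaB, one_smul, mul_neg,
    mul_one_div_cancel (milnor_ne_zero w), neg_smul, one_smul]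
  abel

/-- The operator `μ x∇_x - τ∇_τ` commutes with `τ∇_τ`, and multiplication by `θ` raises its
eigenvalue by one. So the recursion carries the eigenvalue 0 on `ω_0` to `k` on `ω_k`. -/
theorem milnor_smul_eulerX_omega (w : Fin n → ℕ) (k : ℕ) :
    (milnor w : ℂ) • eulerX w (omega w k) = eulerTau w (omega w k) + (k : ℂ) • omega w k := by
  induction k with
  | zero => rw [eulerX_omega_zero]; simp
  | succ k ih =>
    rw [omega_succ]
    simp only [map_smul, map_add, eulerX_theta_smul, eulerX_eulerTau, eulerTau_theta_smul]
    have h : eulerX w (omega w k) = (1 / (milnor w : ℂ)) • (eulerTau w (omega w k) +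
        (k : ℂ) • omega w k) := by
      rw [← ih, smul_smul, one_div_mul_cancel (milnor_ne_zero w), one_smul]
    rw [h, smul_comm (milnor w : ℂ), smul_comm ((k + 1 : ℕ) : ℂ), ← smul_add]
    congr 1
    simp only [map_smul, map_add, smul_comm thetaB (_ : ℂ), smul_add, smul_smul]
    have h1 (c : ℂ) : (milnor w : ℂ) * (1 / milnor w * c) = c := by
      rw [← mul_assoc, mul_one_div_cancel (milnor_ne_zero w), one_mul]
    have h2 (c : ℂ) : (milnor w : ℂ) * (c * (1 / milnor w)) = c := by rw [mul_comm c, h1]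
    rw [h1, h2, mul_left_comm _ _ (1 / (milnor w : ℂ) * k), h1,
      mul_one_div_cancel (milnor_ne_zero w), one_smul, mul_comm ((alpha w k : ℚ) : ℂ)]
    push_cast
    rw [add_smul, one_smul, add_mul, one_mul, add_smul]
    abel

theorem eulerX_omega (w : Fin n → ℕ) (k : ℕ) :
    eulerX w (omega w k) =
      (((sNum w k : ℚ) : ℂ) / milnor w) • omega w k - tauB • omega w (k + 1) := by
  have h := milnor_smul_eulerX_omega w k
  have h0 := milnor_ne_zero w
  have h1 : ((sNum w k : ℚ) : ℂ) = k - ((alpha w k : ℚ) : ℂ) := by simp [alpha]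
  rw [eulerTau_omega] at h
  rw [← one_smul ℂ (eulerX w (omega w k)), ← one_div_mul_cancel h0, mul_smul, h, h1]
  simp only [smul_add, smul_neg, smul_smul, one_div_mul_cancel h0, one_smul]
  rw [sub_div, sub_smul, one_div_mul_eq_div, one_div_mul_eq_div]
  abel

end GaussManin

namespace GaussManin

variable {n : ℕ}

/-! ### The numbers `s_k` -/

theorem spectrumSet_eq_sum (w : Fin n → ℕ) : spectrumSet w =
    {0} + ∑ i, (Multiset.range (w i)).map fun l : ℕ => (l : ℚ) * milnor w / w i := by
  simp [spectrumSet, Multiset.bind_def, Multiset.pure_def, Multiset.bind_singleton]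

theorem card_spectrumSet (w : Fin n → ℕ) : (spectrumSet w).card = milnor w := by
  simp [spectrumSet_eq_sum, milnor, Multiset.card_sum, add_comm]

/-- The nonzero elements of the multiset of the numbers `s_k`. -/
def posSpectrum (w : Fin n → ℕ) : Multiset ℚ :=
  ∑ i, (Multiset.range (w i - 1)).map fun l : ℕ => ((l + 1 : ℕ) : ℚ) * milnor w / w i

/-- Zero occurs once for `w_0 = 1` and once, as `ℓ = 0`, for each of the `n` weights. -/
theorem spectrumSet_eq (w : Fin n → ℕ) (hw : ∀ i, 0 < w i) :
    spectrumSet w = Multiset.replicate (n + 1) 0 + posSpectrum w := by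
  have h (i : Fin n) : (Multiset.range (w i)).map (fun l : ℕ => (l : ℚ) * milnor w / w i) =
      {0} + (Multiset.range (w i - 1)).map fun l : ℕ => ((l + 1 : ℕ) : ℚ) * milnor w / w i := by
    obtain ⟨k, hk⟩ := Nat.exists_eq_add_of_lt (hw i)
    rw [hk, zero_add, Nat.add_sub_cancel, ← Multiset.coe_range, ← Multiset.coe_range,
      List.range_succ_eq_map]
    simp [Function.comp_def]
  have h0 : (∑ _i : Fin n, ({0} : Multiset ℚ)) = Multiset.replicate n 0 := by
    simp [Multiset.nsmul_singleton]
  rw [spectrumSet_eq_sum, Finset.sum_congr rfl fun i _ => h i, Finset.sum_add_distrib, h0, ← add_assoc,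
    add_comm n, Multiset.replicate_add, Multiset.replicate_one, posSpectrum]

theorem posSpectrum_pos (w : Fin n → ℕ) {a : ℚ} (ha : a ∈ posSpectrum w) : 0 < a := by
  rw [posSpectrum, Multiset.mem_sum] at ha
  obtain ⟨i, -, hi⟩ := ha
  obtain ⟨l, hl, rfl⟩ := Multiset.mem_map.1 hi
  rw [Multiset.mem_range] at hl
  have h1 : (0 : ℚ) < w i := by exact_mod_cast (by omega : 0 < w i)
  have h2 : (0 : ℚ) < milnor w := by exact_mod_cast milnor_pos w
  positivity

/-- Within the block of `w_i`, the reflection `ℓ ↦ w_i - ℓ` permutes `1, …, w_i - 1`. -/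
theorem map_sub_posSpectrum (w : Fin n → ℕ) :
    (posSpectrum w).map (fun a => (milnor w : ℚ) - a) = posSpectrum w := by
  rw [posSpectrum, ← Multiset.mapAddMonoidHom_apply, map_sum]
  refine Finset.sum_congr rfl fun i _ => ?_
  simp only [Multiset.mapAddMonoidHom_apply, Multiset.map_map]
  have h : (Multiset.range (w i - 1)).map (fun l => w i - 1 - 1 - l) = Multiset.range (w i - 1) := by
    rw [← Multiset.coe_range, Multiset.map_coe, ← Multiset.coe_reverse]
    exact congrArg _ (List.ext_getElem (by simp) (by simp; intro j hj; omega))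
  conv_rhs => rw [← h, Multiset.map_map]
  refine Multiset.map_congr rfl fun l hl => ?_
  rw [Multiset.mem_range] at hl
  have h1 : (w i : ℚ) ≠ 0 := by exact_mod_cast (by omega : w i ≠ 0)
  have h2 : w i - 1 - 1 - l + 1 = w i - (l + 1) := by omega
  simp only [Function.comp_apply, h2]
  rw [Nat.cast_sub (by omega)]
  field_simp

/-- The list of the nonzero `s_k`. -/
def posList (w : Fin n → ℕ) : List ℚ := (posSpectrum w).sort (· ≤ ·)

theorem coe_posList (w : Fin n → ℕ) : (posList w : Multiset ℚ) = posSpectrum w :=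
  Multiset.sort_eq _ _

theorem sort_spectrumSet (w : Fin n → ℕ) (hw : ∀ i, 0 < w i) :
    (spectrumSet w).sort (· ≤ ·) = List.replicate (n + 1) 0 ++ posList w := by
  refine List.Perm.eq_of_pairwise' (r := (· ≤ ·)) (Multiset.pairwise_sort _ _) ?_ ?_
  · rw [List.pairwise_append]
    refine ⟨List.pairwise_replicate.2 (.inr le_rfl), Multiset.pairwise_sort _ _, ?_⟩
    intro a ha b hb
    rw [List.eq_of_mem_replicate ha]
    exact (posSpectrum_pos w ((Multiset.mem_sort _).1 hb)).le
  · rw [← Multiset.coe_eq_coe, Multiset.sort_eq, ← Multiset.coe_add, coe_posList,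
      Multiset.coe_replicate, spectrumSet_eq w hw]

theorem posList_length (w : Fin n → ℕ) (hw : ∀ i, 0 < w i) :
    n + 1 + (posList w).length = milnor w := by
  have h := congrArg List.length (sort_spectrumSet w hw)
  rw [Multiset.length_sort, card_spectrumSet] at h
  simpa using h.symm

theorem succ_le_milnor (w : Fin n → ℕ) (hw : ∀ i, 0 < w i) : n + 1 ≤ milnor w := by
  rw [← posList_length w hw]; omega

/-- The reflection `a ↦ μ - a` reverses the order, so reversing the reflected list sorts it again.
Two sorted lists with the same elements are equal. -/
theorem map_sub_posList (w : Fin n → ℕ) :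
    ((posList w).map (fun a => (milnor w : ℚ) - a)).reverse = posList w := by
  refine List.Perm.eq_of_pairwise' (r := (· ≤ ·)) ?_ (Multiset.pairwise_sort _ _) ?_
  · rw [List.pairwise_reverse, List.pairwise_map]
    exact (Multiset.pairwise_sort (posSpectrum w) (· ≤ ·)).imp fun h => sub_le_sub_left h _
  · rw [← Multiset.coe_eq_coe, Multiset.coe_reverse, ← Multiset.map_coe, coe_posList,
      map_sub_posSpectrum]

theorem sNum_of_le (w : Fin n → ℕ) (hw : ∀ i, 0 < w i) {k : ℕ} (hk : k ≤ n) : sNum w k = 0 := by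
  rw [sNum, sort_spectrumSet w hw, List.getD_append _ _ _ _ (by simp; omega),
    List.getD_eq_getElem _ _ (by simp; omega), List.getElem_replicate]

theorem sNum_add_sNum (w : Fin n → ℕ) (hw : ∀ i, 0 < w i) {i j : ℕ} (hi : n + 1 ≤ i)
    (hj : n + 1 ≤ j) (hij : i + j = milnor w + n) : sNum w i + sNum w j = milnor w := by
  have hl := posList_length w hw
  have key (k : ℕ) (hk : n + 1 ≤ k) (hk' : k < milnor w) :
      sNum w k = (posList w)[k - (n + 1)]'(by omega) := by
    rw [sNum, sort_spectrumSet w hw, List.getD_append_right _ _ _ _ (by simpa using hk)]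
    simp only [List.length_replicate]
    rw [List.getD_eq_getElem]
  rw [key i hi (by omega), key j hj (by omega)]
  have h := map_sub_posList w
  have h2 : (((posList w).map (fun a => (milnor w : ℚ) - a)).reverse)[i - (n + 1)]'(by simp; omega) =
      (posList w)[i - (n + 1)]'(by omega) := by simp only [h]
  rw [← h2, List.getElem_reverse, List.getElem_map]
  simp only [List.length_map]
  -- The list has `μ - n - 1` entries, so `i + j = μ + n` says exactly that the two positions are
  -- mirror images.
  have h3 : (posList w).length - 1 - (i - (n + 1)) = j - (n + 1) := by omega
  simp only [h3, sub_add_cancel]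

/-- A product over all `k` does not see the ordering of the `s_k`; this regroups it by weights. -/
theorem prod_sNum (w : Fin n → ℕ) {M : Type*} [CommMonoid M] (f : ℚ → M) :
    ∏ k ∈ Finset.range (milnor w), f (sNum w k) =
      f 0 * ∏ i, ∏ l ∈ Finset.range (w i), f ((l : ℚ) * milnor w / w i) := by
  have h1 : ∏ k ∈ Finset.range (milnor w), f (sNum w k) = ((spectrumSet w).map f).prod := by
    rw [← Multiset.sort_eq (spectrumSet w) (· ≤ ·), Multiset.map_coe, Multiset.prod_coe,
      Finset.prod_range, ← List.prod_ofFn]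
    congr 1
    apply List.ext_getElem
    · simp [card_spectrumSet]
    · intro k h1 h2
      simp only [List.getElem_ofFn, List.getElem_map, sNum]
      rw [List.getD_eq_getElem]
  rw [h1, spectrumSet_eq_sum, Multiset.map_add, Multiset.prod_add, Multiset.map_singleton,
    Multiset.prod_singleton, ← Multiset.mapAddMonoidHom_apply, map_sum, Multiset.prod_sum]
  simp [Finset.prod]

end GaussManin

namespace GaussManin

variable {n : ℕ}

/-! ### The relation `ω_μ = c x ω₀` -/

/-- Moving `τ^k` past `τ∇_τ` shifts the operator by `k`, which turns `τ∇_τ + α_k` into `τ∇_τ - s_k`.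
The factors then become polynomials in one operator and can be reordered. -/
theorem tau_pow_smul_omega (w : Fin n → ℕ) (k : ℕ) :
    tauB ^ k • omega w k = (-(1 / (milnor w : ℂ))) ^ k •
      aeval (eulerTau w) (∏ l ∈ Finset.range k, (X - C ((sNum w l : ℚ) : ℂ))) (omega w 0) := by
  induction k with
  | zero => simp
  | succ k ih =>
    have h : tauB ^ (k + 1) • omega w (k + 1) = (-(1 / (milnor w : ℂ))) •
        (eulerTau w (tauB ^ k • omega w k) - ((sNum w k : ℚ) : ℂ) • tauB ^ k • omega w k) := by
      rw [omega_succ, smul_comm (tauB ^ (k + 1)) (_ : ℂ), pow_succ, mul_smul, smul_smul tauB,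
        tauB_thetaB, one_smul, eulerTau_tau_pow_smul]
      congr 1
      rw [smul_add, smul_comm (tauB ^ k) (_ : ℂ), alpha]
      push_cast
      rw [sub_smul]
      abel
    rw [h, ih, Finset.prod_range_succ, mul_comm _ (X - C _), map_mul, Module.End.mul_apply,
      map_smul, smul_comm _ (_ ^ k), ← smul_sub, smul_smul, ← pow_succ', map_sub, aeval_X, aeval_C,
      LinearMap.sub_apply, Module.algebraMap_end_apply]

/-- `τ ^ (|a| + 1) x u₀ u ^ a ω₀`. -/
def pathClass (w : Fin n → ℕ) (a : Fin n → ℕ) : GM w :=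
  tauB ^ (∑ j, a j + 1) • xB • monomialClass w fun j => (a j : ℤ) - w j

/-- In the basic formula for direction `i` the diagonal coefficient simplifies to `a_i μ / w_i`.
Hence the factor `τ∇_τ - ℓμ/w_i` with `ℓ = a_i` kills the diagonal term and only raises `a_i` by
one. -/
theorem eulerTau_pathClass (w : Fin n → ℕ) (i : Fin n) (hw : 0 < w i) (a : Fin n → ℕ) :
    eulerTau w (pathClass w a) = ((a i : ℂ) * milnor w / w i) • pathClass w a -
      ((milnor w : ℂ) / w i) • pathClass w (a + Pi.single i 1) := by
  have h0 : (w i : ℂ) ≠ 0 := Nat.cast_ne_zero.2 hw.ne'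
  have h1 : (fun j => (a j : ℤ) - w j) + Pi.single i 1 =
      fun j => (((a + Pi.single i 1 : Fin n → ℕ) j : ℕ) : ℤ) - w j := by
    ext j
    by_cases h : j = i
    · subst h; simp; ring
    · simp [h]
  have h2 : ∑ j, (a + Pi.single i 1 : Fin n → ℕ) j = ∑ j, a j + 1 := by
    simp [Finset.sum_add_distrib]
  have h3 : tauB ^ (∑ j, a j + 1) • xB • tauB •
      monomialClass w (fun j => (((a + Pi.single i 1 : Fin n → ℕ) j : ℕ) : ℤ) - w j) =
      pathClass w (a + Pi.single i 1) := by
    rw [pathClass, h2, smul_comm xB, smul_smul, ← pow_succ]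
  -- The constant terms cancel because `μ = 1 + ∑ w_j`.
  have h4 : ((∑ j, a j + 1 : ℕ) : ℂ) + ((milnor w : ℂ) / w i * ((a i : ℤ) - w i : ℤ) -
      ∑ j, (((a j : ℤ) - w j : ℤ) : ℂ)) = (a i : ℂ) * milnor w / w i := by
    push_cast
    rw [Finset.sum_sub_distrib]
    field_simp
    rw [milnor_cast]
    ring
  conv_lhs => rw [pathClass]
  rw [eulerTau_tau_pow_smul, eulerTau_x_smul, eulerTau_monomialClass' w i hw, h1, smul_sub,
    smul_sub, smul_comm xB (_ : ℂ), smul_comm xB (_ : ℂ), smul_comm (tauB ^ _) (_ : ℂ),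
    smul_comm (tauB ^ _) (_ : ℂ), h3, ← h4, add_smul, add_sub_assoc]
  rfl

theorem aeval_eulerTau_pathClass (w : Fin n → ℕ) (i : Fin n) (hw : 0 < w i) (a : Fin n → ℕ)
    (ha : a i = 0) (p : ℕ) :
    aeval (eulerTau w) (∏ l ∈ Finset.range p, (X - C ((l : ℂ) * milnor w / w i)))
      (pathClass w a) =
      (-((milnor w : ℂ) / w i)) ^ p • pathClass w (a + Pi.single i p) := by
  induction p with
  | zero => simp
  | succ p ih =>
    rw [Finset.prod_range_succ, mul_comm _ (X - C _), map_mul, Module.End.mul_apply, ih, map_smul,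
      map_sub, aeval_X, aeval_C, LinearMap.sub_apply, Module.algebraMap_end_apply,
      eulerTau_pathClass w i hw, add_assoc, ← Pi.single_add]
    have : (a + Pi.single i p : Fin n → ℕ) i = p := by simp [ha]
    rw [this, sub_sub_cancel_left, ← neg_smul, smul_smul, pow_succ]

theorem aeval_eulerTau_pathClass_zero (w : Fin n → ℕ) (hw : ∀ i, 0 < w i) (S : Finset (Fin n)) :
    aeval (eulerTau w) (∏ i ∈ S, ∏ l ∈ Finset.range (w i), (X - C ((l : ℂ) * milnor w / w i)))
      (pathClass w 0) =
      (∏ i ∈ S, (-((milnor w : ℂ) / w i)) ^ w i) •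
        pathClass w (fun j => if j ∈ S then w j else 0) := by
  induction S using Finset.induction_on with
  | empty => simp; rfl
  | insert i S hi ih =>
    rw [Finset.prod_insert hi, map_mul, Module.End.mul_apply, ih, map_smul,
      aeval_eulerTau_pathClass w i (hw i) _ (by simp [hi]), Finset.prod_insert hi, smul_smul,
      mul_comm]
    congr 2
    ext j
    by_cases h : j = i
    · subst h; simp [hi]
    · simp [h]

theorem tauB_pow_smul_injective (w : Fin n → ℕ) (k : ℕ) {y z : GM w}
    (h : tauB ^ k • y = tauB ^ k • z) : y = z := by
  have h1 := congrArg (fun y => thetaB ^ k • y) h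
  simpa only [smul_smul, ← mul_pow, thetaB_tauB, one_pow, one_smul] using h1

/-- Multiplied by `τ^μ`, the left side is a product of factors `τ∇_τ - s` over the spectrum, applied
to `ω_0`. The factor of `w_0` produces `τ x u_0 ω_0`. The factors of `w_i` then multiply by `(τ
u_i)^{w_i}` up to a constant, and these powers of the `u_i` together cancel `u_0`. -/
theorem omega_milnor (w : Fin n → ℕ) (hw : ∀ i, 0 < w i) :
    omega w (milnor w) = (∏ l, ((w l : ℂ) ^ w l)⁻¹) • xB • omega w 0 := by
  apply tauB_pow_smul_injective w (milnor w)
  have h0 := milnor_ne_zero w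
  rw [tau_pow_smul_omega, prod_sNum w fun q => (X - C (q : ℂ))]
  push_cast
  have h1 : aeval (eulerTau w) (X - C (0 : ℂ)) (omega w 0) =
      (-(milnor w : ℂ)) • pathClass w 0 := by
    rw [map_sub, aeval_X, map_zero, map_zero, sub_zero, ← monomialClass_zero,
      eulerTau_monomialClass, pathClass]
    have : (0 + u0Exp w) = fun j => (((0 : Fin n → ℕ) j : ℕ) : ℤ) - w j := by
      ext j; simp [u0Exp]
    rw [this]
    simp
  have h2 : pathClass w (fun j => if j ∈ Finset.univ then w j else 0) =
      tauB ^ milnor w • xB • omega w 0 := by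
    rw [← monomialClass_zero, pathClass]
    simp only [Finset.mem_univ, if_true, sub_self, milnor, add_comm 1]
    rfl
  -- The factors commute, so the one belonging to `w_0` may act first.
  rw [mul_comm (X - C _), map_mul, Module.End.mul_apply, h1, map_smul,
    aeval_eulerTau_pathClass_zero w hw, h2, smul_smul, smul_smul, smul_comm (tauB ^ _) (_ : ℂ)]
  congr 1
  have h3 : ∏ i, (-((milnor w : ℂ) / w i)) ^ w i =
      (-(milnor w : ℂ)) ^ (∑ i, w i) * ∏ l, ((w l : ℂ) ^ w l)⁻¹ := by
    rw [← Finset.prod_pow_eq_pow_sum, ← Finset.prod_mul_distrib]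
    refine Finset.prod_congr rfl fun i _ => ?_
    rw [← neg_div, div_pow, div_eq_mul_inv]
  rw [h3, ← mul_assoc]
  -- The powers of `-μ` cancel, again by `μ = 1 + ∑ w_i`, which leaves exactly `c`.
  have h4 : (-(1 / (milnor w : ℂ))) ^ milnor w * -(milnor w : ℂ) *
      (-(milnor w : ℂ)) ^ (∑ i, w i) = 1 := by
    have : (-(milnor w : ℂ)) * (-(milnor w : ℂ)) ^ (∑ i, w i) = (-(milnor w : ℂ)) ^ milnor w := by
      rw [← pow_succ', milnor, add_comm]
    rw [mul_assoc, this, ← mul_pow, neg_mul_neg, one_div_mul_cancel h0, one_pow]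
  rw [h4, one_mul]

end GaussManin

namespace GaussManin

variable {n : ℕ}

/-! ### Period functionals

The functional `period w e d` is the coefficient of degree `d` in `τ` of the Mellin transform
`∫∫ x ^ e exp (-τ F) (·)` in `x`, which is given by a product of Gamma functions. -/

/-- The period of `x ^ i u ^ m ω₀`. -/
def gammaTerm (w : Fin n → ℕ) (e : ℂ) (i : ℤ) (m : Fin n → ℤ) : ℂ :=
  Complex.Gamma (e + i) * ∏ j, Complex.Gamma (m j + (e + i) * w j)

/-- The functional on forms which maps `x ^ i τ ^ l u ^ m ω₀` to the period of `x ^ i u ^ m ω₀` if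
this form has degree `d`, and to `0` otherwise. -/
def prePeriod (w : Fin n → ℕ) (e : ℂ) (d : ℤ) : TorusRing n →ₗ[ℂ] ℂ :=
  (Finsupp.lsum ℂ fun m : Fin n → ℤ =>
    (Finsupp.lsum ℂ fun p : ℤ × ℤ =>
      (if p.2 - ∑ j, m j - p.1 * milnor w = d then gammaTerm w e p.1 m else 0) •
        (LinearMap.id : ℂ →ₗ[ℂ] ℂ)) ∘ₗ
    (AddMonoidAlgebra.coeffLinearEquiv (M := ℤ × ℤ) (S := ℂ) ℂ).toLinearMap) ∘ₗ
  (AddMonoidAlgebra.coeffLinearEquiv (M := Fin n → ℤ) (S := Base) ℂ).toLinearMap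

theorem prePeriod_single (w : Fin n → ℕ) (e : ℂ) (d : ℤ) (m : Fin n → ℤ) (i l : ℤ) (c : ℂ) :
    prePeriod w e d (AddMonoidAlgebra.single m (AddMonoidAlgebra.single (i, l) c)) =
      (if l - ∑ j, m j - i * milnor w = d then gammaTerm w e i m else 0) * c := by
  simp only [prePeriod, AddMonoidAlgebra.coeffLinearEquiv]
  split_ifs with h <;> simp [h]

theorem add_int_im (e : ℂ) (i : ℤ) : (e + i).im = e.im := by simp

theorem gamma_arg_im (w : ℕ) (e : ℂ) (i m : ℤ) : ((m : ℂ) + (e + i) * w).im = e.im * w := by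
  simp

theorem ne_zero_of_im_ne_zero {z : ℂ} (hz : z.im ≠ 0) : z ≠ 0 := by
  rintro rfl; simp at hz

/-- The functional equation of Gamma in its `j`-th factor. A nonreal `e` keeps the argument away
from zero. -/
theorem gammaTerm_add_single (w : Fin n → ℕ) (hw : ∀ i, 0 < w i) {e : ℂ} (he : e.im ≠ 0) (i : ℤ)
    (m : Fin n → ℤ) (j : Fin n) :
    gammaTerm w e i (m + Pi.single j 1) = (m j + (e + i) * w j) * gammaTerm w e i m := by
  have h0 : ((m j : ℂ) + (e + i) * w j) ≠ 0 := ne_zero_of_im_ne_zero <| by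
    rw [gamma_arg_im]
    exact mul_ne_zero he (Nat.cast_ne_zero.2 (hw j).ne')
  rw [gammaTerm, gammaTerm, ← Finset.mul_prod_erase _ _ (Finset.mem_univ j),
    ← Finset.mul_prod_erase _ _ (Finset.mem_univ j)]
  have h1 : Complex.Gamma (((m + Pi.single j 1 : Fin n → ℤ) j : ℂ) + (e + i) * w j) =
      (m j + (e + i) * w j) * Complex.Gamma (m j + (e + i) * w j) := by
    rw [← Complex.Gamma_add_one _ h0]
    congr 1
    simp
    ring
  have h2 : ∏ k ∈ Finset.univ.erase j,
      Complex.Gamma (((m + Pi.single j 1 : Fin n → ℤ) k : ℂ) + (e + i) * w k) =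
      ∏ k ∈ Finset.univ.erase j, Complex.Gamma (m k + (e + i) * w k) := by
    refine Finset.prod_congr rfl fun k hk => ?_
    simp [Finset.ne_of_mem_erase hk]
  rw [h1, h2]
  ring

theorem gammaTerm_succ_add_u0Exp (w : Fin n → ℕ) {e : ℂ} (he : e.im ≠ 0) (i : ℤ)
    (m : Fin n → ℤ) :
    gammaTerm w e (i + 1) (m + u0Exp w) = (e + i) * gammaTerm w e i m := by
  have h0 : e + i ≠ 0 := ne_zero_of_im_ne_zero (by rwa [add_int_im])
  rw [gammaTerm, gammaTerm, ← mul_assoc, ← Complex.Gamma_add_one _ h0]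
  congr 1
  · congr 1; push_cast; ring
  · refine Finset.prod_congr rfl fun k _ => ?_
    congr 1
    simp [u0Exp]
    ring

theorem xB_mul_single (i l : ℤ) (c : ℂ) :
    xB * (AddMonoidAlgebra.single (i, l) c : Base) = AddMonoidAlgebra.single (i + 1, l) c := by
  rw [xB, AddMonoidAlgebra.single_mul_single, one_mul, Prod.mk_add_mk, add_comm, zero_add]

theorem tauB_mul_single (i l : ℤ) (c : ℂ) :
    tauB * (AddMonoidAlgebra.single (i, l) c : Base) = AddMonoidAlgebra.single (i, l + 1) c := by
  rw [tauB, AddMonoidAlgebra.single_mul_single, one_mul, Prod.mk_add_mk, add_comm 1, zero_add]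

theorem sum_add_single (m : Fin n → ℤ) (j : Fin n) :
    ∑ k, (m + Pi.single j 1 : Fin n → ℤ) k = ∑ k, m k + 1 := by
  simp [Finset.sum_add_distrib]

theorem sum_add_u0Exp (w : Fin n → ℕ) (m : Fin n → ℤ) :
    ∑ k, (m + u0Exp w) k = ∑ k, m k + 1 - milnor w := by
  simp [Finset.sum_add_distrib, u0Exp, milnor]
  ring

/-- Integrals of exact twisted forms vanish. Algebraically, the three terms of a monomial relation
have the same degree, and their coefficients add up to `m_j - (m_j + (e+i) w_j) + w_j (e+i) = 0`. -/
theorem prePeriod_twistedD (w : Fin n → ℕ) (hw : ∀ i, 0 < w i) {e : ℂ} (he : e.im ≠ 0) (d : ℤ)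
    (h : Fin n → TorusRing n) : prePeriod w e d (twistedD w h) = 0 := by
  rw [← Finset.univ_sum_single h, map_sum, map_sum]
  refine Finset.sum_eq_zero fun j _ => ?_
  generalize h j = f
  induction f using AddMonoidAlgebra.induction_linear with
  | zero => simp
  | add f g hf hg => simp only [Pi.single_add, map_add, hf, hg, add_zero]
  | single m b =>
    induction b using AddMonoidAlgebra.induction_linear with
    | zero => simp
    | add f g hf hg =>
      simp only [AddMonoidAlgebra.single_add, Pi.single_add, map_add, hf, hg, add_zero]
    | single p c =>
      obtain ⟨i, l⟩ := p
      rw [twistedD_single, mul_assoc, xB_mul_single, tauB_mul_single, tauB_mul_single,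
        AddMonoidAlgebra.smul_single, AddMonoidAlgebra.smul_single, map_add, map_sub,
        prePeriod_single, prePeriod_single, prePeriod_single, gammaTerm_add_single w hw he,
        gammaTerm_succ_add_u0Exp w he, sum_add_single, sum_add_u0Exp]
      have h1 : l + 1 - (∑ k, m k + 1) - i * milnor w = l - ∑ k, m k - i * milnor w := by ring
      have h2 : l + 1 - (∑ k, m k + 1 - milnor w) - (i + 1) * milnor w =
        l - ∑ k, m k - i * milnor w := by ring
      rw [h1, h2]
      split_ifs
      · simp only [smul_eq_mul]; ring
      · simp

/-- The functional on `G` induced by `prePeriod`. -/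
def period (w : Fin n → ℕ) (hw : ∀ i, 0 < w i) {e : ℂ} (he : e.im ≠ 0) (d : ℤ) : GM w →ₗ[ℂ] ℂ :=
  Submodule.liftQ ((relations w).restrictScalars ℂ) (prePeriod w e d) (by
    rintro _ ⟨h, rfl⟩
    exact prePeriod_twistedD w hw he d h) ∘ₗ
    (Submodule.Quotient.restrictScalarsEquiv ℂ (relations w)).symm.toLinearMap

theorem period_single_smul (w : Fin n → ℕ) (hw : ∀ i, 0 < w i) {e : ℂ} (he : e.im ≠ 0) (d : ℤ)
    (i l : ℤ) (c : ℂ) (m : Fin n → ℤ) :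
    period w hw he d ((AddMonoidAlgebra.single (i, l) c : Base) • monomialClass w m) =
      (if l - ∑ j, m j - i * milnor w = d then gammaTerm w e i m else 0) * c := by
  rw [← mk_single, ← prePeriod_single]
  rfl

theorem induction_single_smul {w : Fin n → ℕ} {P : GM w → Prop} (y : GM w)
    (zero : P 0) (add : ∀ y z, P y → P z → P (y + z))
    (single : ∀ i l c m, P ((AddMonoidAlgebra.single (i, l) c : Base) • monomialClass w m)) :
    P y := by
  induction y using induction_monomialClass with
  | add y z hy hz => exact add _ _ hy hz
  | monomial b m =>
    induction b using AddMonoidAlgebra.induction_linear with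
    | zero => simpa using zero
    | add f g hf hg => rw [add_smul]; exact add _ _ hf hg
    | single p c => exact single _ _ _ _

theorem period_tau_smul (w : Fin n → ℕ) (hw : ∀ i, 0 < w i) {e : ℂ} (he : e.im ≠ 0) (d : ℤ)
    (y : GM w) : period w hw he d (tauB • y) = period w hw he (d - 1) y := by
  induction y using induction_single_smul with
  | zero => simp
  | add y z hy hz => rw [smul_add, map_add, map_add, hy, hz]
  | single i l c m =>
    rw [smul_smul, tauB_mul_single, period_single_smul, period_single_smul]
    have : l + 1 - ∑ j, m j - i * milnor w = d ↔ l - ∑ j, m j - i * milnor w = d - 1 := by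
      constructor <;> intro h <;> linarith
    simp only [this]

theorem period_theta_smul (w : Fin n → ℕ) (hw : ∀ i, 0 < w i) {e : ℂ} (he : e.im ≠ 0) (d : ℤ)
    (y : GM w) : period w hw he d (thetaB • y) = period w hw he (d + 1) y := by
  have h := period_tau_smul w hw he (d + 1) (thetaB • y)
  rw [smul_smul, tauB_thetaB, one_smul, add_sub_cancel_right] at h
  exact h.symm

theorem add_one_im_ne_zero {e : ℂ} (he : e.im ≠ 0) : (e + 1).im ≠ 0 := by simpa using he

/-- A factor `x` is absorbed in the Mellin kernel `x^e`. The degree moves by `μ` because `x` has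
weight `μ` when each `u_j` has weight 1. -/
theorem period_x_smul (w : Fin n → ℕ) (hw : ∀ i, 0 < w i) {e : ℂ} (he : e.im ≠ 0) (d : ℤ)
    (y : GM w) : period w hw he d (xB • y) =
      period w hw (add_one_im_ne_zero he) (d + milnor w) y := by
  induction y using induction_single_smul with
  | zero => simp
  | add y z hy hz => rw [smul_add, map_add, map_add, hy, hz]
  | single i l c m =>
    rw [smul_smul, xB_mul_single, period_single_smul, period_single_smul]
    have : l - ∑ j, m j - (i + 1) * milnor w = d ↔
        l - ∑ j, m j - i * milnor w = d + milnor w := by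
      constructor <;> intro h <;> linarith
    have h2 : gammaTerm w e (i + 1) m = gammaTerm w (e + 1) i m := by
      simp only [gammaTerm, Int.cast_add, Int.cast_one, add_assoc, add_comm (1 : ℂ)]
    simp only [this, h2]

/-- The full Mellin transform in degree `d` is a multiple of `τ^(d - eμ)`, of which `period` keeps
the coefficient. -/
theorem period_eulerTau (w : Fin n → ℕ) (hw : ∀ i, 0 < w i) {e : ℂ} (he : e.im ≠ 0) (d : ℤ)
    (y : GM w) : period w hw he d (eulerTau w y) = (d - e * milnor w) * period w hw he d y := by
  induction y using induction_single_smul with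
  | zero => simp
  | add y z hy hz => rw [map_add, map_add, map_add, hy, hz, mul_add]
  | single i l c m =>
    rw [eulerTau_smul, tauB_mul_dtauB, eulerDer_single, eulerTau_monomialClass, smul_neg, smul_add,
      smul_comm _ (_ : ℂ), smul_comm _ (_ : ℂ), smul_smul _ tauB, smul_smul _ xB,
      mul_comm _ tauB, tauB_mul_single, mul_comm _ xB, xB_mul_single, map_add, map_neg, map_add,
      (period w hw he d).map_smul, (period w hw he d).map_smul, period_single_smul,
      period_single_smul, period_single_smul, gammaTerm_succ_add_u0Exp w he, sum_add_u0Exp]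
    have h2 : l + 1 - (∑ k, m k + 1 - milnor w) - (i + 1) * milnor w =
        l - ∑ k, m k - i * milnor w := by ring
    rw [h2]
    split_ifs with h
    · rw [← h]
      simp only [smul_eq_mul]
      simp
      ring
    · simp

theorem period_omega (w : Fin n → ℕ) (hw : ∀ i, 0 < w i) {e : ℂ} (he : e.im ≠ 0) (d : ℤ) (k : ℕ) :
    period w hw he d (omega w k) = if d = -(k : ℤ) then
      (∏ l ∈ Finset.range k, (e + (sNum w l : ℚ) / milnor w)) * gammaTerm w e 0 0 else 0 := by
  induction k generalizing d with
  | zero =>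
    have h := period_single_smul w hw he d 0 0 1 0
    rw [← Prod.zero_eq_mk, ← AddMonoidAlgebra.one_def, one_smul, monomialClass_zero] at h
    rw [h]
    simp [eq_comm]
  | succ k ih =>
    have h0 := milnor_ne_zero w
    rw [omega_succ, map_smul, period_theta_smul, map_add, map_smul, period_eulerTau, ih]
    have h1 : d + 1 = -(k : ℤ) ↔ d = -((k + 1 : ℕ) : ℤ) := by
      push_cast; constructor <;> intro h <;> linarith
    simp only [h1]
    split_ifs with h
    · rw [h, Finset.prod_range_succ, alpha]
      simp only [smul_eq_mul]
      push_cast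
      field_simp
      ring
    · simp

/-! ### Quotients of periods as polynomials in `e`. -/

theorem gamma_add_nat {z : ℂ} (hz : z.im ≠ 0) (p : ℕ) :
    Complex.Gamma (z + p) = (∏ l ∈ Finset.range p, (z + l)) * Complex.Gamma z := by
  induction p with
  | zero => simp
  | succ p ih =>
    rw [Nat.cast_succ, ← add_assoc, Complex.Gamma_add_one _ (ne_zero_of_im_ne_zero (by simpa)), ih,
      Finset.prod_range_succ]
    ring

/-- The quotient of the periods of `ω₀` at `e + 1` and `e`, as a polynomial in `e`. -/
def shiftPoly (w : Fin n → ℕ) : ℂ[X] :=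
  X * ∏ j, ∏ l ∈ Finset.range (w j), (C (w j : ℂ) * X + C (l : ℂ))

theorem degree_shiftPoly (w : Fin n → ℕ) (hw : ∀ i, 0 < w i) :
    (shiftPoly w).degree = milnor w := by
  have h (j : Fin n) (l : ℕ) : (C (w j : ℂ) * X + C (l : ℂ)).degree = 1 :=
    degree_linear (Nat.cast_ne_zero.2 (hw j).ne')
  rw [shiftPoly, degree_mul, degree_X, degree_prod]
  simp only [degree_prod, h, Finset.sum_const, Finset.card_range]
  simp [milnor]

theorem gammaTerm_add_one (w : Fin n → ℕ) (hw : ∀ i, 0 < w i) {e : ℂ} (he : e.im ≠ 0) :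
    gammaTerm w (e + 1) 0 0 = (shiftPoly w).eval e * gammaTerm w e 0 0 := by
  simp only [gammaTerm, Int.cast_zero, add_zero, Pi.zero_apply, zero_add, shiftPoly, eval_mul,
    eval_X, eval_prod, eval_add, eval_C]
  rw [Complex.Gamma_add_one _ (ne_zero_of_im_ne_zero he), mul_mul_mul_comm,
    ← Finset.prod_mul_distrib]
  congr 1
  refine Finset.prod_congr rfl fun j _ => ?_
  rw [add_mul, one_mul, gamma_add_nat, mul_comm e]
  simpa using ⟨he, (hw j).ne'⟩

theorem gammaTerm_ne_zero (w : Fin n → ℕ) (hw : ∀ i, 0 < w i) {e : ℂ} (he : e.im ≠ 0) :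
    gammaTerm w e 0 0 ≠ 0 := by
  have h {z : ℂ} (hz : z.im ≠ 0) : Complex.Gamma z ≠ 0 :=
    Complex.Gamma_ne_zero fun m h => hz (by rw [h]; simp)
  refine mul_ne_zero (h (by simpa)) (Finset.prod_ne_zero_iff.2 fun j _ => h ?_)
  simpa using ⟨he, (hw j).ne'⟩

/-- The quotient of the periods of `x ^ j ω_k` and `ω₀` at `e`, as a polynomial in `e`. -/
def periodPoly (w : Fin n → ℕ) : ℕ → ℕ → ℂ[X]
  | 0, k => ∏ l ∈ Finset.range k, (X + C ((sNum w l : ℂ) / milnor w))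
  | j + 1, k => (periodPoly w j k).comp (X + C 1) * shiftPoly w

theorem degree_periodPoly (w : Fin n → ℕ) (hw : ∀ i, 0 < w i) (j k : ℕ) :
    (periodPoly w j k).degree = (milnor w * j + k : ℕ) := by
  induction j with
  | zero => simp only [periodPoly, degree_prod, degree_X_add_C]; simp
  | succ j ih =>
    have h : ((periodPoly w j k).comp (X + C 1)).degree = (milnor w * j + k : ℕ) := by
      rw [← taylor_apply, degree_taylor, ih]
    rw [periodPoly, degree_mul, h, degree_shiftPoly w hw, ← Nat.cast_add]
    congr 1
    ring

theorem period_x_pow_omega (w : Fin n → ℕ) (hw : ∀ i, 0 < w i) {e : ℂ} (he : e.im ≠ 0) (d : ℤ)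
    (j k : ℕ) :
    period w hw he d (xB ^ j • omega w k) =
      if d + (milnor w * j + k : ℕ) = 0 then (periodPoly w j k).eval e * gammaTerm w e 0 0
      else 0 := by
  induction j generalizing e d with
  | zero =>
    rw [pow_zero, one_smul, period_omega, periodPoly]
    have : d = -(k : ℤ) ↔ d + (milnor w * 0 + k : ℕ) = 0 := by
      rw [mul_zero, zero_add]; omega
    simp only [this, eval_prod, eval_add, eval_X, eval_C]
  | succ j ih =>
    rw [pow_succ', mul_smul, period_x_smul, ih, gammaTerm_add_one w hw he, periodPoly]
    have : d + milnor w + (milnor w * j + k : ℕ) = 0 ↔ d + (milnor w * (j + 1) + k : ℕ) = 0 := by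
      push_cast; constructor <;> intro h <;> linarith
    simp only [this, eval_mul, eval_comp, eval_add, eval_X, eval_C]
    split_ifs
    · ring
    · rfl

end GaussManin

namespace GaussManin

variable {n : ℕ}

/-! ### The `ω_k` are linearly independent, and their classes are bases of the fibres -/

theorem algebraMap_base (p : ℂ[X]) : algebraMap ℂ[X] Base p = aeval xB p := rfl

theorem X_smul (w : Fin n → ℕ) (y : GM w) : (X : ℂ[X]) • y = xB • y := by
  rw [← algebraMap_smul Base (X : ℂ[X]) y, algebraMap_base, aeval_X]

theorem C_smul (w : Fin n → ℕ) (c : ℂ) (y : GM w) : (C c : ℂ[X]) • y = c • y := by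
  rw [← algebraMap_smul Base (C c : ℂ[X]) y, algebraMap_base, aeval_C, algebraMap_smul]

theorem monomial_smul (w : Fin n → ℕ) (j : ℕ) (c : ℂ) (y : GM w) :
    (monomial j c : ℂ[X]) • y = c • xB ^ j • y := by
  rw [← algebraMap_smul Base (monomial j c : ℂ[X]) y, algebraMap_base, aeval_monomial, mul_smul,
    algebraMap_smul]

/-- The polynomials `periodPoly`, ordered by their degrees. -/
def periodSequence (w : Fin n → ℕ) (hw : ∀ i, 0 < w i) : Polynomial.Sequence ℂ where
  elems' N := periodPoly w (N / milnor w) (N % milnor w)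
  degree_eq' N := by rw [degree_periodPoly w hw, Nat.div_add_mod]

/-- The basis of `ℂ[X]` given by the polynomials `periodPoly`. -/
def periodBasis (w : Fin n → ℕ) (hw : ∀ i, 0 < w i) : Module.Basis ℕ ℂ ℂ[X] :=
  (periodSequence w hw).basis fun N =>
    isUnit_iff_ne_zero.2 (leadingCoeff_ne_zero.2 ((periodSequence w hw).ne_zero N))

theorem periodBasis_apply (w : Fin n → ℕ) (hw : ∀ i, 0 < w i) (j : ℕ) (k : Fin (milnor w)) :
    periodBasis w hw (milnor w * j + k) = periodPoly w j k := by
  rw [periodBasis, Polynomial.Sequence.basis_eq_self]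
  change periodPoly w _ _ = _
  rw [Nat.mul_add_div (milnor_pos w), Nat.div_eq_of_lt k.2, add_zero, Nat.mul_add_mod,
    Nat.mod_eq_of_lt k.2]

/-- The periods of degree `d` of a combination of the `t ^ i ω_k`, divided by that of `ω₀`, where
`t` has degree `ε`. -/
def combinationPoly (w : Fin n → ℕ) (ε d : ℤ) : (ℕ × Fin (milnor w) →₀ ℂ[X]) →ₗ[ℂ] ℂ[X] :=
  Finsupp.lsum ℂ fun p => (basisMonomials ℂ).constr ℂ fun j =>
    if d - ε * p.1 + (milnor w * j + p.2 : ℕ) = 0 then periodPoly w j p.2 else 0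

theorem combinationPoly_single (w : Fin n → ℕ) (ε d : ℤ) (p : ℕ × Fin (milnor w)) (j : ℕ) (c : ℂ) :
    combinationPoly w ε d (Finsupp.single p (monomial j c)) =
      c • if d - ε * p.1 + (milnor w * j + p.2 : ℕ) = 0 then periodPoly w j p.2 else 0 := by
  have : (monomial j c : ℂ[X]) = c • basisMonomials ℂ j := by simp [smul_monomial]
  rw [combinationPoly, Finsupp.lsum_single, this, map_smul, Module.Basis.constr_basis]

theorem finsupp_polynomial_induction {ι : Type*} {P : (ι →₀ ℂ[X]) → Prop} (f : ι →₀ ℂ[X])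
    (zero : P 0) (add : ∀ f g, P f → P g → P (f + g))
    (single : ∀ p j c, P (Finsupp.single p (monomial j c))) : P f := by
  induction f using Finsupp.induction_linear with
  | zero => exact zero
  | add f g hf hg => exact add _ _ hf hg
  | single p a =>
    induction a using Polynomial.induction_on' with
    | add a b ha hb => rw [Finsupp.single_add]; exact add _ _ ha hb
    | monomial j c => exact single p j c

variable (w : Fin n → ℕ)

/-- The Gamma factor of `ω_0` is common to all terms, so that a vanishing combination forces
polynomial identities in `e`. -/
theorem period_linearCombination (hw : ∀ i, 0 < w i) {e : ℂ} (he : e.im ≠ 0) {t : Base} {ε : ℤ}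
    (ht : ∀ d y, period w hw he d (t • y) = period w hw he (d - ε) y) (d : ℤ)
    (f : ℕ × Fin (milnor w) →₀ ℂ[X]) :
    period w hw he d (Finsupp.linearCombination ℂ[X]
      (fun p : ℕ × Fin (milnor w) => t ^ p.1 • omega w (p.2 : ℕ)) f) =
      (combinationPoly w ε d f).eval e * gammaTerm w e 0 0 := by
  induction f using finsupp_polynomial_induction with
  | zero => simp
  | add f g hf hg => rw [map_add, map_add, map_add, eval_add, hf, hg, add_mul]
  | single p j c =>
    have hpow (i : ℕ) (y : GM w) :
        period w hw he d (t ^ i • y) = period w hw he (d - ε * i) y := by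
      induction i generalizing d with
      | zero => simp
      | succ i ih =>
        rw [pow_succ', mul_smul, ht, ih]
        congr 2
        push_cast
        ring
    rw [Finsupp.linearCombination_single, monomial_smul, smul_comm (xB ^ j), map_smul, hpow,
      period_x_pow_omega, combinationPoly_single]
    split_ifs
    · rw [eval_smul, smul_eq_mul, smul_eq_mul, mul_assoc]
    · simp

/-- A term `t^i x^j ω_k` contributes to degree `d` only if `d = ε i - (μj + k)`. Once `(j, k)` and
`d` are fixed, `i` is determined, so reading one basis coordinate in one degree isolates one
coefficient of `f`. -/
theorem coord_combinationPoly (hw : ∀ i, 0 < w i) {ε : ℤ} (hε : ε ≠ 0) (p : ℕ × Fin (milnor w)) (j : ℕ)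
    (f : ℕ × Fin (milnor w) →₀ ℂ[X]) :
    (periodBasis w hw).coord (milnor w * j + p.2)
      (combinationPoly w ε (ε * p.1 - (milnor w * j + p.2 : ℕ)) f) = (f p).coeff j := by
  induction f using finsupp_polynomial_induction with
  | zero => simp
  | add f g hf hg => rw [map_add, map_add, hf, hg, Finsupp.add_apply, coeff_add]
  | single q j' c =>
    have hinj : milnor w * j' + (q.2 : ℕ) = milnor w * j + (p.2 : ℕ) → j' = j ∧ q.2 = p.2 := by
      intro h
      have h1 := congrArg (· / milnor w) h
      have h2 := congrArg (· % milnor w) h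
      simp only [Nat.mul_add_div (milnor_pos w), Nat.div_eq_of_lt (Fin.is_lt _), add_zero] at h1
      simp only [Nat.mul_add_mod, Nat.mod_eq_of_lt (Fin.is_lt _)] at h2
      exact ⟨h1, Fin.ext h2⟩
    rw [combinationPoly_single, map_smul]
    by_cases hq : q = p
    · subst hq
      rw [Finsupp.single_eq_same, coeff_monomial]
      by_cases hj : j' = j
      · subst hj
        rw [if_pos (by ring), ← periodBasis_apply w hw]
        simp
      · rw [if_neg hj, if_neg]
        · simp
        · intro h
          exact hj (hinj (by zify; push_cast at h; linarith)).1
    · rw [Finsupp.single_eq_of_ne (Ne.symm hq), coeff_zero]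
      split_ifs with h
      · rw [← periodBasis_apply w hw, Module.Basis.coord_apply, Module.Basis.repr_self,
          Finsupp.single_apply, if_neg, smul_zero]
        intro h'
        refine hq (Prod.ext ?_ (hinj h').2)
        rw [h'] at h
        -- Equal degree and equal `μj + k` leave only the powers of `t` to compare; `ε ≠ 0` makes
        -- these equal.
        have h3 : ε * ((p.1 : ℤ) - q.1) = 0 := by linarith
        have h4 := (mul_eq_zero.1 h3).resolve_left hε
        omega
      · simp

theorem infinite_im_ne_zero : {e : ℂ | e.im ≠ 0}.Infinite := by
  have h : Function.Injective fun k : ℕ => (k : ℂ) + Complex.I := fun a b hab => by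
    simpa using hab
  refine (Set.infinite_range_of_injective h).mono ?_
  rintro _ ⟨k, rfl⟩
  simp

theorem linearIndependent_pow_smul_omega (hw : ∀ i, 0 < w i) {t : Base} {ε : ℤ} (hε : ε ≠ 0)
    (ht : ∀ {e : ℂ} (he : e.im ≠ 0) (d : ℤ) (y : GM w),
      period w hw he d (t • y) = period w hw he (d - ε) y) :
    LinearIndependent ℂ[X] fun p : ℕ × Fin (milnor w) => t ^ p.1 • omega w (p.2 : ℕ) := by
  rw [linearIndependent_iff]
  intro f hf
  have h (d : ℤ) : combinationPoly w ε d f = 0 := by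
    -- The Gamma factor never vanishes at nonreal `e`, so the polynomial has infinitely many roots.
    refine eq_zero_of_infinite_isRoot _ (infinite_im_ne_zero.mono fun e he => ?_)
    have h1 := period_linearCombination w hw he (ht he) d f
    rw [hf, map_zero, eq_comm, mul_eq_zero] at h1
    exact h1.resolve_right (gammaTerm_ne_zero w hw he)
  ext p j
  rw [← coord_combinationPoly w hw hε, h, map_zero]
  simp

theorem linearIndependent_tau (hw : ∀ i, 0 < w i) :
    LinearIndependent ℂ[X] fun p : ℕ × Fin (milnor w) => tauB ^ p.1 • omega w (p.2 : ℕ) :=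
  linearIndependent_pow_smul_omega w hw (ε := 1) one_ne_zero fun he d y =>
    period_tau_smul w hw he d y

theorem linearIndependent_theta (hw : ∀ i, 0 < w i) :
    LinearIndependent ℂ[X] fun p : ℕ × Fin (milnor w) => thetaB ^ p.1 • omega w (p.2 : ℕ) :=
  linearIndependent_pow_smul_omega w hw (ε := -1) (by decide) fun he d y => by
    rw [period_theta_smul, sub_neg_eq_add]

/-! ### Bases of the lattices and of their fibres. -/

variable {w}
variable {t : Base} (hli : LinearIndependent ℂ[X]
  fun p : ℕ × Fin (milnor w) => t ^ p.1 • omega w (p.2 : ℕ))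

/-- The basis `t ^ i ω_k` of the lattice. -/
def latticeBasis : Module.Basis (ℕ × Fin (milnor w)) ℂ[X] (lattice w t) := Module.Basis.span hli

theorem latticeBasis_apply (p : ℕ × Fin (milnor w)) :
    (latticeBasis hli p : GM w) = t ^ p.1 • omega w (p.2 : ℕ) :=
  congrArg Subtype.val (Module.Basis.span_apply hli p)

theorem mulGM_apply (b : Base) (y : GM w) : mulGM w b y = b • y := rfl

theorem smul_mem_lattice {y : GM w} (hy : y ∈ lattice w t) : t • y ∈ lattice w t := by
  rw [lattice] at hy ⊢
  induction hy using Submodule.span_induction with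
  | mem y hy =>
    obtain ⟨p, rfl⟩ := hy
    simp only [smul_smul, ← pow_succ']
    exact Submodule.subset_span ⟨(p.1 + 1, p.2), rfl⟩
  | zero => rw [smul_zero]; exact zero_mem _
  | add y z _ _ hy hz => rw [smul_add]; exact add_mem hy hz
  | smul p y _ hy =>
    rw [← mulGM_apply, map_smul, mulGM_apply]
    exact Submodule.smul_mem _ _ hy

/-- Multiplication by `t` on the lattice. -/
def latticeMul (w : Fin n → ℕ) (t : Base) : lattice w t →ₗ[ℂ[X]] lattice w t :=
  LinearMap.codRestrict _ ((mulGM w t).domRestrict (lattice w t)) fun y => smul_mem_lattice y.2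

theorem coe_latticeMul (y : lattice w t) : (latticeMul w t y : GM w) = t • (y : GM w) := rfl

/-- The constant coefficient in `t` of an element of the lattice. -/
def constCoeff : lattice w t →ₗ[ℂ[X]] (Fin (milnor w) → ℂ[X]) :=
  LinearMap.pi fun k => (latticeBasis hli).coord (0, k)

/-- Multiplication by `t` raises the first index of the basis and never reaches a vector with index
`(0, k)`. -/
theorem constCoeff_latticeMul (y : lattice w t) : constCoeff hli (latticeMul w t y) = 0 := by
  have h : constCoeff hli ∘ₗ latticeMul w t = 0 := by
    refine (latticeBasis hli).ext fun p => ?_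
    have h1 : latticeMul w t (latticeBasis hli p) = latticeBasis hli (p.1 + 1, p.2) := by
      apply Subtype.ext
      rw [coe_latticeMul, latticeBasis_apply, latticeBasis_apply, pow_succ', mul_smul]
    rw [LinearMap.comp_apply, h1]
    ext k : 1
    simp [constCoeff]
  exact LinearMap.congr_fun h y

/-- The coordinates on the fibre with respect to the classes of the `ω_k`. -/
def fibreCoord : Fibre w t →ₗ[ℂ[X]] (Fin (milnor w) → ℂ[X]) :=
  Submodule.liftQ _ (constCoeff hli) (by
    rintro y ⟨z, hz, hzy⟩
    have h : y = latticeMul w t ⟨z, hz⟩ := Subtype.ext hzy.symm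
    rw [LinearMap.mem_ker, h, constCoeff_latticeMul])

theorem fibreCoord_cls (k : Fin (milnor w)) : fibreCoord hli (cls w t k) = Pi.single k 1 := by
  have h : (⟨omega w k, Submodule.subset_span ⟨(0, k), by simp⟩⟩ : lattice w t) =
      latticeBasis hli (0, k) := by
    apply Subtype.ext
    rw [latticeBasis_apply]
    simp
  rw [cls, fibreCoord, Submodule.liftQ_apply, h]
  ext k' : 1
  simp [constCoeff, Finsupp.single_apply, Pi.single_apply, eq_comm]

theorem hasClass_smul {y : GM w} (hy : y ∈ lattice w t) : HasClass w t (t • y) 0 :=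
  ⟨smul_mem_lattice hy, (Submodule.Quotient.mk_eq_zero _).2 ⟨y, hy, rfl⟩⟩

theorem HasClass.add {y z : GM w} {a b : Fibre w t} (hy : HasClass w t y a)
    (hz : HasClass w t z b) : HasClass w t (y + z) (a + b) := by
  obtain ⟨h1, rfl⟩ := hy
  obtain ⟨h2, rfl⟩ := hz
  exact ⟨add_mem h1 h2, rfl⟩

theorem HasClass.smul {y : GM w} {a : Fibre w t} (p : ℂ[X]) (hy : HasClass w t y a) :
    HasClass w t (p • y) (p • a) := by
  obtain ⟨h1, rfl⟩ := hy
  exact ⟨Submodule.smul_mem _ _ h1, rfl⟩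

theorem HasClass.unique {y : GM w} {a b : Fibre w t} (ha : HasClass w t y a)
    (hb : HasClass w t y b) : a = b := by
  obtain ⟨h1, rfl⟩ := ha
  obtain ⟨h2, rfl⟩ := hb
  rfl

theorem omega_mem_lattice (k : Fin (milnor w)) : omega w k ∈ lattice w t :=
  Submodule.subset_span ⟨(0, k), by simp⟩

theorem hasClass_omega (k : Fin (milnor w)) : HasClass w t (omega w k) (cls w t k) :=
  ⟨omega_mem_lattice k, rfl⟩

theorem span_cls : ⊤ ≤ Submodule.span ℂ[X] (Set.range (cls w t)) := by
  rintro e -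
  obtain ⟨⟨y, hy⟩, rfl⟩ := Submodule.Quotient.mk_surjective _ e
  have h : ∃ e' ∈ Submodule.span ℂ[X] (Set.range (cls w t)), HasClass w t y e' := by
    induction hy using Submodule.span_induction with
    | mem y hy =>
      obtain ⟨⟨i, k⟩, rfl⟩ := hy
      cases i with
      | zero => exact ⟨_, Submodule.subset_span ⟨k, rfl⟩, by simpa using hasClass_omega k⟩
      | succ i =>
        refine ⟨0, zero_mem _, ?_⟩
        simp only [pow_succ', mul_smul]
        exact hasClass_smul (Submodule.subset_span ⟨(i, k), rfl⟩)
    | zero => exact ⟨0, zero_mem _, zero_mem _, rfl⟩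
    | add y z _ _ hy hz =>
      obtain ⟨a, ha, hya⟩ := hy
      obtain ⟨b, hb, hzb⟩ := hz
      exact ⟨a + b, add_mem ha hb, hya.add hzb⟩
    | smul p y _ hy =>
      obtain ⟨a, ha, hya⟩ := hy
      exact ⟨p • a, Submodule.smul_mem _ _ ha, hya.smul p⟩
  obtain ⟨e', he', h⟩ := h
  rwa [HasClass.unique (⟨hy, rfl⟩ : HasClass w t y _) h]

/-- The basis of the fibre given by the classes of the `ω_k`. -/
def fibreBasis : Module.Basis (Fin (milnor w)) ℂ[X] (Fibre w t) :=
  Module.Basis.mk (v := cls w t) (LinearIndependent.of_comp (fibreCoord hli) (by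
    have h : (fibreCoord hli) ∘ cls w t = Pi.basisFun ℂ[X] (Fin (milnor w)) := by
      ext1 k
      rw [Function.comp_apply, fibreCoord_cls, Pi.basisFun_apply]
    rw [h]
    exact (Pi.basisFun ℂ[X] (Fin (milnor w))).linearIndependent)) span_cls

theorem fibreBasis_apply (k : Fin (milnor w)) : fibreBasis hli k = cls w t k := by
  simp [fibreBasis]

end GaussManin

namespace GaussManin

variable {n : ℕ}

/-! ### The explicit Frobenius type structure -/

theorem X_mul_divX_apply (ξ : LogDer) : X * (ξ.1 X).divX = ξ.1 X := by
  obtain ⟨q, hq⟩ := ξ.2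
  have h := divX_mul_X_add (ξ.1 X)
  rwa [hq, mul_coeff_zero, coeff_X_zero, zero_mul, C_0, add_zero, mul_comm, ← hq] at h

/-- The coefficient `f` of a logarithmic vector field `f x ∂ₓ`. -/
def logCoeff : LogDer →ₗ[ℂ[X]] ℂ[X] where
  toFun ξ := (ξ.1 X).divX
  map_add' ξ η := by
    apply mul_left_cancel₀ (X_ne_zero (R := ℂ))
    rw [mul_add, X_mul_divX_apply, X_mul_divX_apply, X_mul_divX_apply]
    rfl
  map_smul' p ξ := by
    apply mul_left_cancel₀ (X_ne_zero (R := ℂ))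
    rw [RingHom.id_apply, smul_eq_mul, mul_left_comm, X_mul_divX_apply, X_mul_divX_apply]
    rfl

theorem logDer_apply_X (ξ : LogDer) : ξ.1 X = X * logCoeff ξ := (X_mul_divX_apply ξ).symm

theorem logDer_apply_C (ξ : LogDer) (c : ℂ) : ξ.1 (C c) = 0 := ξ.1.map_algebraMap c

theorem logDer_apply_mul (ξ : LogDer) (p q : ℂ[X]) : ξ.1 (p * q) = p * ξ.1 q + q * ξ.1 p := by
  rw [Derivation.leibniz, smul_eq_mul, smul_eq_mul]

theorem logLie_apply (ξ η : LogDer) (p : ℂ[X]) :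
    (logLie ξ η).1 p = ξ.1 (η.1 p) - η.1 (ξ.1 p) := Derivation.commutator_apply _

theorem logCoeff_logLie (ξ η : LogDer) :
    logCoeff (logLie ξ η) = ξ.1 (logCoeff η) - η.1 (logCoeff ξ) := by
  apply mul_left_cancel₀ (X_ne_zero (R := ℂ))
  rw [← logDer_apply_X, logLie_apply, logDer_apply_X, logDer_apply_X, logDer_apply_mul,
    logDer_apply_mul, logDer_apply_X, logDer_apply_X]
  ring

/-- The residue exponent `s_k / μ`. -/
def residue (w : Fin n → ℕ) (k : ℕ) : ℂ := ((sNum w k : ℚ) : ℂ) / milnor w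

theorem alpha_eq (w : Fin n → ℕ) (k : ℕ) :
    ((alpha w k : ℚ) : ℂ) = k - milnor w * residue w k := by
  rw [residue, mul_div_cancel₀ _ (milnor_ne_zero w), alpha]
  push_cast
  rfl

/-- The residue exponent of `ω_{k+1}`, where `ω_μ = c x ω₀`. -/
def nextResidue (w : Fin n → ℕ) (k : ℕ) : ℂ := if k + 1 < milnor w then residue w (k + 1) else 1

/-- The constant `c = ∏ w_i ^ (- w_i)`. -/
def wrapConst (w : Fin n → ℕ) : ℂ := ∏ l, ((w l : ℂ) ^ w l)⁻¹

variable {w : Fin n → ℕ} {E : Type*} [AddCommGroup E] [Module ℂ[X] E]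
  (b : Module.Basis (Fin (milnor w)) ℂ[X] E)

/-- The vector which corresponds to `ω_{k+1}`, where `ω_μ = c x ω₀`. -/
def nextVec (k : Fin (milnor w)) : E :=
  if h : (k : ℕ) + 1 < milnor w then b ⟨k + 1, h⟩
  else (C (wrapConst w) * X) • b ⟨0, milnor_pos w⟩

/-- The cyclic endomorphism `ω_k ↦ ω_{k+1}`. -/
def shiftEnd : Module.End ℂ[X] E := b.constr ℂ[X] (nextVec b)

theorem shiftEnd_basis (k : Fin (milnor w)) : shiftEnd b (b k) = nextVec b k :=
  Module.Basis.constr_basis _ _ _ _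

/-- The endomorphism `ω_k ↦ - α_k ω_k`. -/
def weightEnd : Module.End ℂ[X] E :=
  b.constr ℂ[X] fun k => C (-((alpha w k : ℚ) : ℂ)) • b k

theorem weightEnd_basis (k : Fin (milnor w)) :
    weightEnd b (b k) = C (-((alpha w k : ℚ) : ℂ)) • b k :=
  Module.Basis.constr_basis _ _ _ _

/-- The connection for which `x ∂ₓ` maps `ω_k` to `(s_k / μ) ω_k`. -/
def diagConn : LogDer →ₗ[ℂ[X]] (E →+ E) where
  toFun ξ :=
    { toFun := fun e =>
        ∑ k, (ξ.1 (b.repr e k) + logCoeff ξ * C (residue w k) * b.repr e k) • b k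
      map_zero' := by simp
      map_add' := fun x y => by
        rw [← Finset.sum_add_distrib]
        refine Finset.sum_congr rfl fun k _ => ?_
        rw [← add_smul, map_add, Finsupp.add_apply, map_add]
        congr 1
        ring }
  map_add' ξ η := by
    ext e
    simp only [AddMonoidHom.coe_mk, ZeroHom.coe_mk, AddMonoidHom.add_apply,
      ← Finset.sum_add_distrib, ← add_smul]
    refine Finset.sum_congr rfl fun k _ => ?_
    congr 1
    rw [Submodule.coe_add, Derivation.add_apply, map_add]
    ring
  map_smul' p ξ := by
    ext e
    simp only [AddMonoidHom.coe_mk, ZeroHom.coe_mk, AddMonoidHom.smul_apply, RingHom.id_apply,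
      Finset.smul_sum, smul_smul]
    refine Finset.sum_congr rfl fun k _ => ?_
    congr 1
    rw [Submodule.coe_smul, Derivation.smul_apply, map_smul, smul_eq_mul, smul_eq_mul]
    ring

theorem diagConn_apply (ξ : LogDer) (e : E) : diagConn b ξ e =
    ∑ k, (ξ.1 (b.repr e k) + logCoeff ξ * C (residue w k) * b.repr e k) • b k := rfl

theorem diagConn_smul_basis (ξ : LogDer) (p : ℂ[X]) (k : Fin (milnor w)) :
    diagConn b ξ (p • b k) = (ξ.1 p + logCoeff ξ * C (residue w k) * p) • b k := by
  rw [diagConn_apply, Finset.sum_eq_single k]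
  · simp
  · intro j _ hj
    simp [hj.symm]
  · simp

theorem basis_induction {P : E → Prop} (e : E) (zero : P 0) (add : ∀ x y, P x → P y → P (x + y))
    (smul : ∀ (p : ℂ[X]) k, P (p • b k)) : P e := by
  rw [← b.sum_repr e]
  exact Finset.sum_induction _ P add zero fun k _ => smul _ _

/-- The data `(R₀, R_∞, Φ, ▽)` in terms of the basis of the `[ω_k]`. -/
def modelData : LogFrobeniusData E where
  R0 := C (milnor w : ℂ) • shiftEnd b
  Rinf := weightEnd b
  Phi := LinearMap.toSpanSingleton ℂ[X] (Module.End ℂ[X] E) (-shiftEnd b) ∘ₗ logCoeff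
  conn := diagConn b
  leibniz ξ f e := by
    induction e using basis_induction b with
    | zero => simp
    | add x y hx hy => simp only [smul_add, map_add, hx, hy]; abel
    | smul p k =>
      rw [smul_smul, diagConn_smul_basis, diagConn_smul_basis, logDer_apply_mul, smul_smul,
        smul_smul, ← add_smul]
      congr 1
      ring

theorem modelData_R0 (e : E) : (modelData b).R0 e = C (milnor w : ℂ) • shiftEnd b e := rfl

theorem modelData_Rinf : (modelData b).Rinf = weightEnd b := rfl

theorem modelData_conn : (modelData b).conn = diagConn b := rfl

theorem modelData_Phi (ξ : LogDer) (e : E) :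
    (modelData b).Phi ξ e = -(logCoeff ξ • shiftEnd b e) := by
  rw [← smul_neg]
  rfl

variable {b} in
theorem logFrobeniusData_ext {D D' : LogFrobeniusData E} (h0 : ∀ k, D.R0 (b k) = D'.R0 (b k))
    (hinf : ∀ k, D.Rinf (b k) = D'.Rinf (b k)) (hPhi : ∀ ξ k, D.Phi ξ (b k) = D'.Phi ξ (b k))
    (hconn : ∀ ξ k, D.conn ξ (b k) = D'.conn ξ (b k)) : D = D' := by
  refine LogFrobeniusData.ext (b.ext h0) (b.ext hinf)
    (LinearMap.ext fun ξ => b.ext (hPhi ξ)) (LinearMap.ext fun ξ => AddMonoidHom.ext fun e => ?_)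
  induction e using basis_induction b with
  | zero => simp
  | add x y hx hy => simp only [map_add, hx, hy]
  | smul p k => rw [D.leibniz, D'.leibniz, hconn]

theorem residue_zero (hw : ∀ i, 0 < w i) : residue w 0 = 0 := by
  rw [residue, sNum_of_le w hw (Nat.zero_le _)]
  simp

/-- In the wrapped case the residue of `ω_0` is 0 and the eigenvalue 1 comes from differentiating
`x`. -/
theorem diagConn_smul_nextVec (hw : ∀ i, 0 < w i) (ξ : LogDer) (p : ℂ[X]) (k : Fin (milnor w)) :
    diagConn b ξ (p • nextVec b k) =
      (ξ.1 p + logCoeff ξ * C (nextResidue w k) * p) • nextVec b k := by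
  rw [nextVec, nextResidue]
  split_ifs with h
  · rw [diagConn_smul_basis]
  · rw [smul_smul, diagConn_smul_basis, residue_zero hw, smul_smul, logDer_apply_mul,
      logDer_apply_mul, logDer_apply_C, logDer_apply_X, C_0, C_1]
    congr 1
    ring

theorem weightEnd_nextVec (hw : ∀ i, 0 < w i) (k : Fin (milnor w)) :
    weightEnd b (nextVec b k) =
      C (milnor w * nextResidue w k - ((k : ℕ) + 1)) • nextVec b k := by
  rw [nextVec, nextResidue]
  split_ifs with h
  · rw [weightEnd_basis, alpha_eq]
    congr 2
    push_cast
    ring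
  · have hk : ((k : ℕ) : ℂ) + 1 = milnor w := by
      have : (k : ℕ) + 1 = milnor w := by omega
      exact_mod_cast this
    rw [map_smul, weightEnd_basis, alpha_eq, residue_zero hw, hk]
    simp

/-- On `p • b k` each differential relation compares multiples of the single vector `b k` or
`nextVec b k`, and becomes a scalar identity. The two purely algebraic relations hold since `R_0`
and `Φ` are multiples of the same `N`. -/
theorem isLogFrobeniusTypeWithoutMetric_modelData (hw : ∀ i, 0 < w i) :
    IsLogFrobeniusTypeWithoutMetric (modelData b) where
  free := Module.Free.of_basis b
  finite := Module.Finite.of_basis b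
  conn_flat ξ η e := by
    rw [modelData_conn]
    induction e using basis_induction b with
    | zero => simp
    | add x y hx hy => simp only [map_add, ← hx, ← hy]; abel
    | smul p k =>
      simp only [diagConn_smul_basis, ← sub_smul, map_add, logDer_apply_mul, logDer_apply_C,
        logCoeff_logLie, logLie_apply]
      congr 1
      ring
  conn_Rinf ξ e := by
    rw [modelData_conn, modelData_Rinf]
    induction e using basis_induction b with
    | zero => simp
    | add x y hx hy => simp only [map_add, add_sub_add_comm, hx, hy, add_zero]
    | smul p k =>
      simp only [map_smul, weightEnd_basis, diagConn_smul_basis, smul_smul, ← sub_smul,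
        logDer_apply_mul, logDer_apply_C]
      rw [show ∀ r : ℂ[X], r = 0 → r • b k = 0 from fun r h => by rw [h, zero_smul]]
      ring
  Phi_wedge_Phi ξ η := by
    ext e
    simp only [LinearMap.sub_apply, Module.End.mul_apply, modelData_Phi, map_neg, map_smul,
      LinearMap.zero_apply, smul_neg, neg_neg]
    rw [smul_comm, sub_self]
  R0_Phi ξ := by
    ext e
    simp only [LinearMap.sub_apply, Module.End.mul_apply, modelData_Phi, modelData_R0, map_neg,
      map_smul, LinearMap.zero_apply, smul_neg]
    rw [smul_comm, sub_self]
  conn_Phi ξ η e := by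
    rw [modelData_conn]
    simp only [modelData_Phi]
    induction e using basis_induction b with
    | zero => simp
    | add x y hx hy =>
      simp only [map_add, smul_add, neg_add, ← hx, ← hy]
      abel
    | smul p k =>
      simp only [map_smul, shiftEnd_basis, smul_smul, ← neg_smul, diagConn_smul_nextVec b hw,
        diagConn_smul_basis, ← sub_smul, logCoeff_logLie, map_neg, logDer_apply_mul]
      congr 1
      ring
  conn_R0 ξ e := by
    rw [modelData_conn, modelData_Rinf]
    simp only [modelData_Phi, modelData_R0]
    induction e using basis_induction b with
    | zero => simp
    | add x y hx hy =>
      have h : ∀ a a' b b' c c' : E, (a + a' - (b + b')) + (c + c') =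
        (a - b + c) + (a' - b' + c') := fun _ _ _ _ _ _ => by abel
      simp only [map_add, smul_add, neg_add, h, hx, hy]
      abel
    | smul p k =>
      simp only [map_smul, map_neg, shiftEnd_basis, weightEnd_basis, smul_smul, ← neg_smul,
        diagConn_smul_nextVec b hw, diagConn_smul_basis, ← sub_smul, ← add_smul,
        weightEnd_nextVec b hw, logDer_apply_mul, logDer_apply_C]
      -- With `r = s_k/μ` and `r'` the next residue, both sides have coefficient `μ(r' - r) - 1` up
      -- to the common factor; this is `α_k = k - μ r` combined with the weight `μ r' - (k+1)` of
      -- `nextVec b k`.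
      congr 1
      rw [alpha_eq]
      simp only [map_sub, map_add, map_mul, C_1]
      ring

/-! ### The form `g` and its compatibility relations. -/

/-- The form `g` in terms of the basis of the `[ω_k]`. -/
def modelForm : LinearMap.BilinForm ℂ[X] E :=
  b.constr ℂ[X] fun i => b.constr ℂ[X] fun j => gram w i j

theorem modelForm_basis (i j : Fin (milnor w)) : modelForm b (b i) (b j) = gram w i j := by
  simp [modelForm]

variable {b} in
theorem bilinForm_ext {g g' : LinearMap.BilinForm ℂ[X] E}
    (h : ∀ i j, g (b i) (b j) = g' (b i) (b j)) : g = g' :=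
  b.ext fun i => b.ext fun j => h i j

theorem gram_symm (i j : Fin (milnor w)) : gram w i j = gram w j i := by
  simp only [gram, add_comm (i : ℕ)]
  congr 2
  exact propext ⟨fun h => ⟨h.2.1, h.1, h.2.2⟩, fun h => ⟨h.2.1, h.1, h.2.2⟩⟩

theorem modelForm_symm (x y : E) : modelForm b x y = modelForm b y x := by
  have h : modelForm b = (modelForm b).flip := bilinForm_ext (b := b) fun i j => by
    change _ = modelForm b (b j) (b i)
    rw [modelForm_basis, modelForm_basis, gram_symm]
  exact LinearMap.congr_fun₂ h x y

/-- Flatness on the basis: the power of `x` in a nonzero entry is the sum of the two residues,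
namely 0 or 1. -/
theorem logDer_apply_gram (hw : ∀ i, 0 < w i) (ξ : LogDer) (i j : Fin (milnor w)) :
    ξ.1 (gram w i j) = logCoeff ξ * C (residue w i + residue w j) * gram w i j := by
  have h0 := milnor_ne_zero w
  rw [gram]
  split_ifs with h1 h2
  · rw [residue, residue, sNum_of_le w hw (by omega), sNum_of_le w hw (by omega)]
    simp
  · have h := sNum_add_sNum w hw h2.1 h2.2.1 h2.2.2
    have h3 : residue w i + residue w j = 1 := by
      rw [residue, residue, ← add_div, div_eq_one_iff_eq h0]
      exact_mod_cast h
    rw [h3, logDer_apply_mul, logDer_apply_C, logDer_apply_X, C_1]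
    ring
  · simp

/-- On both kinds of nonzero entries `α_i + α_j = n`, whence the constant `r = -n`. -/
theorem weight_mul_gram (hw : ∀ i, 0 < w i) (i j : Fin (milnor w)) :
    (C (-((alpha w i : ℚ) : ℂ)) + C (-((alpha w j : ℚ) : ℂ))) * gram w i j =
      C (-(n : ℂ)) * gram w i j := by
  rw [← C_add, gram]
  split_ifs with h1 h2
  · have h : alpha w i + alpha w j = n := by
      rw [alpha, alpha, sNum_of_le w hw (by omega), sNum_of_le w hw (by omega), sub_zero,
        sub_zero]
      exact_mod_cast h1
    congr 2
    rw [← neg_add, ← Rat.cast_add, h, Rat.cast_natCast]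
  · have h : alpha w i + alpha w j = n := by
      have h3 : ((i : ℕ) : ℚ) + (j : ℕ) = milnor w + n := by exact_mod_cast h2.2.2
      have h4 := sNum_add_sNum w hw h2.1 h2.2.1 h2.2.2
      rw [alpha, alpha]
      linarith
    congr 2
    rw [← neg_add, ← Rat.cast_add, h, Rat.cast_natCast]
  · simp

theorem modelForm_nextVec_of_lt {i j : Fin (milnor w)} (hi : (i : ℕ) + 1 < milnor w) :
    modelForm b (nextVec b i) (b j) = gram w ⟨i + 1, hi⟩ j := by
  rw [nextVec, dif_pos hi, modelForm_basis]

theorem modelForm_nextVec_of_not_lt {i j : Fin (milnor w)} (hi : ¬(i : ℕ) + 1 < milnor w) :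
    modelForm b (nextVec b i) (b j) = C (wrapConst w) * X * gram w ⟨0, milnor_pos w⟩ j := by
  rw [nextVec, dif_neg hi, map_smul, LinearMap.smul_apply, modelForm_basis, smul_eq_mul]

/-- Self-adjointness of `N`. Away from the last index it holds because the nonzero entries are
governed by `i + j`; at the last index the factor `c x` in `N` has to match the factor `c x` in
`gram`. -/
theorem modelForm_nextVec (hw : ∀ i, 0 < w i) (i j : Fin (milnor w)) :
    modelForm b (nextVec b i) (b j) = modelForm b (nextVec b j) (b i) := by
  have hμ := succ_le_milnor w hw
  have key (i j : Fin (milnor w)) (hi : (i : ℕ) + 1 < milnor w) (hj : ¬(j : ℕ) + 1 < milnor w) :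
      modelForm b (nextVec b i) (b j) = modelForm b (nextVec b j) (b i) := by
    rw [modelForm_nextVec_of_lt b hi, modelForm_nextVec_of_not_lt b hj, gram, gram, wrapConst]
    -- Here `j = μ - 1`. The only nonzero pairing is at `i = n`, where the entry at `(n+1, μ-1)` and
    -- the one at `(0, n)` multiplied by `c x` agree.
    by_cases h : (i : ℕ) = n
    · rw [if_neg (by simp only; omega), if_pos (by simp only; omega), if_pos (by simp only; omega),
        mul_one]
    · rw [if_neg (by simp only; omega), if_neg (by simp only; omega), if_neg (by simp only; omega),
        if_neg (by simp only; omega), mul_zero]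
  by_cases hi : (i : ℕ) + 1 < milnor w <;> by_cases hj : (j : ℕ) + 1 < milnor w
  · rw [modelForm_nextVec_of_lt b hi, modelForm_nextVec_of_lt b hj, gram, gram]
    have h1 : (i : ℕ) + 1 + j = n ↔ (j : ℕ) + 1 + i = n := by omega
    have h2 : (n + 1 ≤ (i : ℕ) + 1 ∧ n + 1 ≤ (j : ℕ) ∧ (i : ℕ) + 1 + j = milnor w + n) ↔
        (n + 1 ≤ (j : ℕ) + 1 ∧ n + 1 ≤ (i : ℕ) ∧ (j : ℕ) + 1 + i = milnor w + n) := by omega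
    simp only [h1, h2]
  · exact key i j hi hj
  · exact (key j i hj hi).symm
  · have : i = j := Fin.ext (by omega)
    rw [this]

theorem modelForm_shiftEnd (hw : ∀ i, 0 < w i) (x y : E) :
    modelForm b (shiftEnd b x) y = modelForm b x (shiftEnd b y) := by
  have h : modelForm b ∘ₗ shiftEnd b = (modelForm b).compl₂ (shiftEnd b) :=
    bilinForm_ext (b := b) fun i j => by
      rw [LinearMap.comp_apply, LinearMap.compl₂_apply, shiftEnd_basis, shiftEnd_basis,
        modelForm_nextVec b hw, modelForm_symm]
  exact LinearMap.congr_fun₂ h x y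

theorem isCompatibleForm_modelForm (hw : ∀ i, 0 < w i) :
    IsCompatibleForm (modelData b) (modelForm b) where
  symm := modelForm_symm b
  flat ξ x y := by
    rw [modelData_conn]
    induction x using basis_induction b with
    | zero => simp
    | add x x' hx hx' => simp only [map_add, LinearMap.add_apply, hx, hx']; ring
    | smul p i =>
      induction y using basis_induction b with
      | zero => simp
      | add y y' hy hy' => simp only [map_add, hy, hy']; ring
      | smul q j =>
        simp only [diagConn_smul_basis, map_smul, LinearMap.smul_apply, smul_eq_mul,
          modelForm_basis, logDer_apply_mul, logDer_apply_gram hw, C_add]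
        ring
  Phi_adj ξ x y := by
    simp only [modelData_Phi, map_neg, map_smul, LinearMap.neg_apply, LinearMap.smul_apply,
      modelForm_shiftEnd b hw]
  R0_adj x y := by
    simp only [modelData_R0, map_smul, LinearMap.smul_apply, modelForm_shiftEnd b hw]
  Rinf_adj := by
    refine ⟨-(n : ℂ), fun x y => ?_⟩
    have h : modelForm b ∘ₗ weightEnd b + (modelForm b).compl₂ (weightEnd b) =
        C (-(n : ℂ)) • modelForm b := bilinForm_ext (b := b) fun i j => by
      rw [LinearMap.add_apply, LinearMap.add_apply, LinearMap.comp_apply, LinearMap.compl₂_apply,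
        weightEnd_basis, weightEnd_basis, map_smul, map_smul, LinearMap.smul_apply,
        LinearMap.smul_apply, LinearMap.smul_apply, modelForm_basis, smul_eq_mul, smul_eq_mul,
        smul_eq_mul, ← add_mul, weight_mul_gram hw]
    exact LinearMap.congr_fun₂ h x y

/-- No index reaches `n + 1`, so the Gram matrix is antidiagonal with ones: `g` maps the basis to
the reversed dual basis. -/
theorem isNondegenerate_modelForm (h : milnor w = n + 1) : IsNondegenerate (modelForm b) := by
  have hg : modelForm b = (b.equiv b.dualBasis Fin.revPerm).toLinearMap := by
    refine b.ext fun i => b.ext fun j => ?_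
    rw [modelForm_basis, LinearEquiv.coe_coe, Module.Basis.equiv_apply,
      Module.Basis.dualBasis_apply_self, gram, if_neg (show ¬(_ ∧ _ ∧ _) by omega)]
    congr 1
    rw [Fin.revPerm_apply, Fin.ext_iff, Fin.val_rev, eq_iff_iff]
    omega
  rw [IsNondegenerate, hg]
  exact (b.equiv b.dualBasis Fin.revPerm).bijective

/-- Since `μ - 1 > n`, every pairing with the last basis vector is divisible by `x`, whereas the
last coordinate functional takes the value 1 there. It is therefore not in the image of `g`. -/
theorem not_isNondegenerate_modelForm (h : n + 2 ≤ milnor w) :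
    ¬ IsNondegenerate (modelForm b) := by
  intro hg
  obtain ⟨a, ha⟩ := hg.2 (b.coord ⟨milnor w - 1, by omega⟩)
  have h1 := LinearMap.congr_fun ha (b ⟨milnor w - 1, by omega⟩)
  rw [Module.Basis.coord_apply, Module.Basis.repr_self, Finsupp.single_eq_same] at h1
  have h2 (a : E) : X ∣ modelForm b a (b ⟨milnor w - 1, by omega⟩) := by
    induction a using basis_induction b with
    | zero => simp
    | add x y hx hy => rw [map_add, LinearMap.add_apply]; exact dvd_add hx hy
    | smul p k =>
      rw [map_smul, LinearMap.smul_apply, modelForm_basis, smul_eq_mul]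
      refine Dvd.dvd.mul_left ?_ p
      rw [gram, if_neg (by simp only; omega)]
      split_ifs
      · exact dvd_mul_left _ _
      · exact dvd_zero _
  replace h2 := h2 a
  rw [h1] at h2
  exact Polynomial.not_isUnit_X (isUnit_of_dvd_one h2)

end GaussManin

namespace GaussManin

variable {n : ℕ}

/-! ### The induced data are the explicit ones -/

variable {w : Fin n → ℕ} {t : Base}

theorem HasClass.neg {y : GM w} {a : Fibre w t} (hy : HasClass w t y a) :
    HasClass w t (-y) (-a) := by
  obtain ⟨h1, rfl⟩ := hy
  exact ⟨neg_mem h1, rfl⟩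

theorem hasClass_omega_succ (hw : ∀ i, 0 < w i)
    {b : Module.Basis (Fin (milnor w)) ℂ[X] (Fibre w t)} (hb : ∀ k, b k = cls w t k)
    (k : Fin (milnor w)) : HasClass w t (omega w (k + 1)) (nextVec b k) := by
  rw [nextVec]
  split_ifs with h
  · rw [hb]
    exact hasClass_omega ⟨k + 1, h⟩
  · have hk : (k : ℕ) + 1 = milnor w := by omega
    rw [hk, omega_milnor w hw, ← X_smul, ← C_smul, smul_smul, hb]
    exact (hasClass_omega ⟨0, milnor_pos w⟩).smul _

theorem nablaLog_omega (ξ : LogDer) (k : ℕ) : nablaLog w ξ (omega w k) =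
    logCoeff ξ • (C (residue w k) • omega w k - tauB • omega w (k + 1)) := by
  rw [nablaLog, logDer_apply_X, mul_comm, mul_smul, X_smul, C_smul, ← eulerX_apply, eulerX_omega]
  rfl

theorem base_smul_polynomial_smul (b : Base) (p : ℂ[X]) (y : GM w) : b • p • y = p • b • y := by
  rw [← mulGM_apply, map_smul, mulGM_apply]

/-- As `θ²∇_θ = -∇_τ`, the recursion gives `θ α_k ω_k + μ ω_{k+1}`, and the first term dies modulo
`θ`. -/
theorem hasClass_R0 (hw : ∀ i, 0 < w i) {b : Module.Basis (Fin (milnor w)) ℂ[X] (Elog w)}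
    (hb : ∀ k, b k = cls w thetaB k) (k : Fin (milnor w)) :
    HasClass w thetaB (thetaB ^ 2 • nablaTheta w (omega w k)) ((modelData b).R0 (b k)) := by
  have h : thetaB ^ 2 • nablaTheta w (omega w k) =
      thetaB • (C ((alpha w k : ℚ) : ℂ) : ℂ[X]) • omega w k +
        C (milnor w : ℂ) • omega w (k + 1) := by
    rw [nablaTheta, smul_neg, smul_smul, ← mul_pow, thetaB_tauB, one_pow, one_smul,
      ← one_smul Base (nablaTau w _), ← thetaB_tauB, mul_smul, ← eulerTau_apply, eulerTau_omega,
      smul_neg, neg_neg, smul_add, C_smul, C_smul, smul_comm thetaB (milnor w : ℂ),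
      smul_smul thetaB tauB, thetaB_tauB, one_smul]
  rw [h, modelData_R0, shiftEnd_basis, ← zero_add (C (milnor w : ℂ) • nextVec b k)]
  exact (hasClass_smul (Submodule.smul_mem _ _ (omega_mem_lattice k))).add
    ((hasClass_omega_succ hw hb k).smul _)

theorem hasClass_Phi (hw : ∀ i, 0 < w i) {b : Module.Basis (Fin (milnor w)) ℂ[X] (Elog w)}
    (hb : ∀ k, b k = cls w thetaB k) (ξ : LogDer) (k : Fin (milnor w)) :
    HasClass w thetaB (thetaB • nablaLog w ξ (omega w k)) ((modelData b).Phi ξ (b k)) := by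
  have h : thetaB • nablaLog w ξ (omega w k) =
      thetaB • logCoeff ξ • C (residue w k) • omega w k + -(logCoeff ξ • omega w (k + 1)) := by
    rw [nablaLog_omega, smul_sub, smul_sub, base_smul_polynomial_smul thetaB _ (tauB • _),
      smul_smul thetaB tauB, thetaB_tauB, one_smul, sub_eq_add_neg]
  rw [h, modelData_Phi, shiftEnd_basis, ← zero_add (-(logCoeff ξ • nextVec b k))]
  exact (hasClass_smul (Submodule.smul_mem _ _ (Submodule.smul_mem _ _ (omega_mem_lattice k)))).add
    ((hasClass_omega_succ hw hb k).smul _).neg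

/-- The same recursion read modulo `τ`: now the term in `ω_{k+1}` dies and the diagonal one remains.
-/
theorem hasClass_Rinf (hw : ∀ i, 0 < w i) {b : Module.Basis (Fin (milnor w)) ℂ[X] (Einf w)}
    (hb : ∀ k, b k = cls w tauB k) (k : Fin (milnor w)) :
    HasClass w tauB (tauB • nablaTau w (omega w k)) (C (-((alpha w k : ℚ) : ℂ)) • b k) := by
  have h : tauB • nablaTau w (omega w k) =
      (C (-((alpha w k : ℚ) : ℂ)) : ℂ[X]) • omega w k +
        tauB • (C (-(milnor w : ℂ)) : ℂ[X]) • omega w (k + 1) := by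
    rw [← eulerTau_apply, eulerTau_omega, C_smul, C_smul, neg_smul, neg_smul, smul_neg, neg_add,
      smul_comm tauB (_ : ℂ)]
  rw [h, hb, ← add_zero (C (-((alpha w k : ℚ) : ℂ)) • cls w tauB k)]
  obtain ⟨hmem, -⟩ := hasClass_omega_succ hw hb k
  exact ((hasClass_omega k).smul _).add (hasClass_smul (Submodule.smul_mem _ _ hmem))

theorem hasClass_conn (hw : ∀ i, 0 < w i) {b : Module.Basis (Fin (milnor w)) ℂ[X] (Einf w)}
    (hb : ∀ k, b k = cls w tauB k) (ξ : LogDer) (k : Fin (milnor w)) :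
    HasClass w tauB (nablaLog w ξ (omega w k))
      ((logCoeff ξ * C (residue w k)) • b k) := by
  have h : nablaLog w ξ (omega w k) =
      (logCoeff ξ * C (residue w k)) • omega w k + -(tauB • logCoeff ξ • omega w (k + 1)) := by
    rw [nablaLog_omega, smul_sub, smul_smul, base_smul_polynomial_smul tauB, sub_eq_add_neg]
  rw [h, hb, ← add_zero ((logCoeff ξ * C (residue w k)) • cls w tauB k), ← neg_zero]
  obtain ⟨hmem, -⟩ := hasClass_omega_succ hw hb k
  exact ((hasClass_omega k).smul _).add (hasClass_smul (Submodule.smul_mem _ _ hmem)).neg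

theorem diagConn_basis {E : Type*} [AddCommGroup E] [Module ℂ[X] E]
    (b : Module.Basis (Fin (milnor w)) ℂ[X] E) (ξ : LogDer) (k : Fin (milnor w)) :
    diagConn b ξ (b k) = (logCoeff ξ * C (residue w k)) • b k := by
  have h := diagConn_smul_basis b ξ 1 k
  rwa [one_smul, Derivation.map_one_eq_zero, zero_add, mul_one] at h

variable {b : Module.Basis (Fin (milnor w)) ℂ[X] (Elog w)}
  {b' : Module.Basis (Fin (milnor w)) ℂ[X] (Einf w)}

theorem isInduced_modelData (hw : ∀ i, 0 < w i) (hb : ∀ k, b k = cls w thetaB k)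
    (hb' : ∀ k, b' k = cls w tauB k) : IsInduced w (modelData b) (modelForm b) where
  R0 k := by
    rw [← hb]
    exact hasClass_R0 hw hb k
  Phi ξ k := by
    rw [← hb]
    exact hasClass_Phi hw hb ξ k
  Rinf_conn := by
    -- The identification of the two fibres matches their bases index by index.
    have hι (k : Fin (milnor w)) : b.equiv b' (Equiv.refl _) (b k) = b' k := by simp
    refine ⟨b.equiv b' (Equiv.refl _), fun k => ?_, fun k => ?_, fun ξ k => ?_⟩
    · rw [← hb, ← hb', hι]
    · rw [← hb, modelData_Rinf, weightEnd_basis, map_smul, hι]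
      exact hasClass_Rinf hw hb' k
    · rw [← hb, modelData_conn, diagConn_basis, map_smul, hι]
      exact hasClass_conn hw hb' ξ k
  g i j := by rw [← hb, ← hb, modelForm_basis]

/-- An element of a lattice has only one class, so the data are forced on a basis; linearity and the
Leibniz rule determine the rest. -/
theorem IsInduced.eq_model (hw : ∀ i, 0 < w i) (hb : ∀ k, b k = cls w thetaB k)
    (hb' : ∀ k, b' k = cls w tauB k) {D : LogFrobeniusData (Elog w)}
    {g : LinearMap.BilinForm ℂ[X] (Elog w)} (h : IsInduced w D g) :
    D = modelData b ∧ g = modelForm b := by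
  obtain ⟨ι, hι, hinf, hconn⟩ := h.Rinf_conn
  refine ⟨logFrobeniusData_ext (b := b) (fun k => ?_) (fun k => ?_) (fun ξ k => ?_)
    fun ξ k => ?_, bilinForm_ext (b := b) fun i j => ?_⟩
  · refine HasClass.unique ?_ (hasClass_R0 hw hb k)
    rw [hb]
    exact h.R0 k
  · apply ι.injective
    rw [modelData_Rinf, weightEnd_basis, map_smul, hb, hι, ← hb']
    exact HasClass.unique (hinf k) (hasClass_Rinf hw hb' k)
  · refine HasClass.unique ?_ (hasClass_Phi hw hb ξ k)
    rw [hb]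
    exact h.Phi ξ k
  · apply ι.injective
    rw [modelData_conn, diagConn_basis, map_smul, hb, hι, ← hb']
    exact HasClass.unique (hconn ξ k) (hasClass_conn hw hb' ξ k)
  · rw [modelForm_basis, hb, hb, h.g]

end GaussManin

end

open GaussManin Polynomial in
theorem corollary6p2 (n : ℕ) (hn : 0 < n) (w : Fin n → ℕ) (hw : ∀ i, 0 < w i) :
    (∃! P : LogFrobeniusData (Elog w) × LinearMap.BilinForm ℂ[X] (Elog w),
      IsInduced w P.1 P.2) ∧
    ∀ (D : LogFrobeniusData (Elog w)) (g : LinearMap.BilinForm ℂ[X] (Elog w)),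
      IsInduced w D g →
        (milnor w = n + 1 → IsLogFrobeniusType D g) ∧
        (n + 2 ≤ milnor w →
          IsLogFrobeniusTypeWithoutMetric D ∧ IsCompatibleForm D g ∧ ¬ IsNondegenerate g) := by
  have hb := fibreBasis_apply (linearIndependent_theta w hw)
  have hb' := fibreBasis_apply (linearIndependent_tau w hw)
  refine ⟨⟨(_, _), isInduced_modelData hw hb hb', ?_⟩, ?_⟩
  · rintro ⟨D, g⟩ h
    obtain ⟨rfl, rfl⟩ := IsInduced.eq_model hw hb hb' h
    rfl
  · intro D g h
    obtain ⟨rfl, rfl⟩ := IsInduced.eq_model hw hb hb' h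
    have h1 := isLogFrobeniusTypeWithoutMetric_modelData
      (fibreBasis (linearIndependent_theta w hw)) hw
    have h2 := isCompatibleForm_modelForm (fibreBasis (linearIndependent_theta w hw)) hw
    exact ⟨fun hμ => ⟨h1, h2, isNondegenerate_modelForm _ hμ⟩,
      fun hμ => ⟨h1, h2, not_isNondegenerate_modelForm _ hμ⟩⟩
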